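/- Let $\Bbbk$ be a field of characteristic $0$, let $N$ be a lattice with basis $e_1,e_2$ and a skew-symmetric bilinear form $\{\cdot,\cdot\}\colon N\times N\to\mathbb{Q}$, and let $N^+=\{a_1e_1+a_2e_2 : a_1,a_2\in\mathbb{Z}_{\ge 0},\ a_1+a_2>0\}$. Let $\mathfrak g=\bigoplus_{n\in N^+}\Bbbk X_n$ be the Lie algebra with $[X_n,X_{n'}]=\{n,n'\}X_{n+n'}$. Let $\mathcal L$ be the set of all $L\subseteq N^+$ with $N^++L\subseteq L$ and $N^+\setminus L$ finite. For $L\in\mathcal L$ let $\mathfrak g_L$ be the quotient of $\mathfrak g$ by the ideal $\bigoplus_{n\in L}\Bbbk X_n$, and let $G_L=\exp_L(\mathfrak g_L)$ be the group whose product is given by the Baker–Campbell–Hausdorff formula (a finite sum, since $\mathfrak g_L$ is nilpotent). Let $\hat{\mathfrak g}=\varprojlim_{L}\mathfrak g_L$, let $G=\varprojlim_{L}G_L$ be the structure group, and let $\exp\colon\hat{\mathfrak g}\to G$ be the bijection induced by the maps $\exp_L$. For $g=\exp(X)\in G$ and $c\in\mathbb{Q}$ put $g^c=\exp(cX)$,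 and for $n\in N^+$ put $$[n]=\exp\Bigl(\sum_{j>0}\frac{(-1)^{j+1}}{j^2}X_{jn}\Bigr)\in G .$$ An infinite product converges to $g\in G$ if, for every $L\in\mathcal L$, the images of its partial products in $G_L$ are eventually equal to the image of $g$; here $\prod^{\to}_{p\ge 0}a_p=a_0a_1a_2\cdots$ and $\prod^{\leftarrow}_{p\ge 0}a_p=\cdots a_2a_1a_0$, and $\prod_{p\ge0}a_p$ without an arrow means that the finite products over distinct indices $p$, taken in any order, converge in this sense as the set of indices grows. **Theorem.** Let $n,n'\in N^+$ and $c\in\mathbb{Q}\setminus\{0\}$ with $\{n',n\}=c^{-1}$. Then the three infinite products below converge in $G$, and $$[n']^{2c}[n]^{2c}=\prod^{\longrightarrow}_{p\ge 0}[n+p(n+n')]^{2c}\cdot\prod_{p\ge 0}[2^p(n+n')]^{4c/2^p}\cdot\prod^{\longleftarrow}_{p\ge 0}[n'+p(n+n')]^{2c}.$$ -/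

import Mathlib

/-! ### The Baker-Campbell-Hausdorff product -/

section BCH

variable {k : Type*} [Field k] {𝔤 : Type*} [LieRing 𝔤] [LieAlgebra k 𝔤]

/-- The right-nested bracket `[a₁, [a₂, [… , [aₘ₋₁, aₘ] … ]]]` of a list of elements. -/
def nestedBracket {𝔤 : Type*} [LieRing 𝔤] : List 𝔤 → 𝔤
  | [] => 0
  | [a] => a
  | a :: b :: l => ⁅a, nestedBracket (b :: l)⁆

/-- The word `X^{r₁} Y^{s₁} X^{r₂} Y^{s₂} ⋯ X^{rₗ} Y^{sₗ}`, where `e i = (rᵢ, sᵢ)`. -/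
def bchWord {α : Type*} {l : ℕ} (X Y : α) (e : Fin l → ℕ × ℕ) : List α :=
  (List.ofFn fun i => List.replicate (e i).1 X ++ List.replicate (e i).2 Y).flatten

/-- The exponents `((r₁, s₁), …, (rₗ, sₗ))` with `rᵢ + sᵢ > 0` for all `i` and
`∑ᵢ (rᵢ + sᵢ) = m`. -/
def bchExponents (m l : ℕ) : Finset (Fin l → ℕ × ℕ) :=
  (Fintype.piFinset fun _ => Finset.range (m + 1) ×ˢ Finset.range (m + 1)).filter
    fun e => (∀ i, 0 < (e i).1 + (e i).2) ∧ ∑ i, ((e i).1 + (e i).2) = m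

variable (k) in
/-- The homogeneous part of degree `m` of the Baker-Campbell-Hausdorff series `log (e^X e^Y)`,
in Dynkin's form
`∑ₗ (-1)^(l-1)/l ∑_{(r,s)} [X^{r₁} Y^{s₁} ⋯ X^{rₗ} Y^{sₗ}] / (m ∏ᵢ rᵢ! sᵢ!)`. -/
noncomputable def bchTerm (m : ℕ) (X Y : 𝔤) : 𝔤 :=
  ∑ l ∈ Finset.Icc 1 m, ∑ e ∈ bchExponents m l,
    ((-1 : k) ^ (l + 1) / ((l : k) * (m : k) *
      ∏ i, (((e i).1.factorial : k) * ((e i).2.factorial : k)))) •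
        nestedBracket (bchWord X Y e)

variable (k) in
/-- The Baker-Campbell-Hausdorff series. In a nilpotent Lie algebra all but finitely many of the
terms vanish. -/
noncomputable def bch (X Y : 𝔤) : 𝔤 := ∑ᶠ m : ℕ, bchTerm k m X Y

theorem map_nestedBracket {𝔥 : Type*} [LieRing 𝔥] [LieAlgebra k 𝔥] (f : 𝔤 →ₗ⁅k⁆ 𝔥) (w : List 𝔤) :
    f (nestedBracket w) = nestedBracket (w.map f) := by
  induction w with
  | nil => simp [nestedBracket]
  | cons a w ih =>
    cases w with
    | nil => simp [nestedBracket]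
    | cons b w =>
      simp only [nestedBracket, LieHom.map_lie, List.map_cons] at ih ⊢
      rw [ih]

theorem map_bchWord {α β : Type*} {l : ℕ} (f : α → β) (X Y : α) (e : Fin l → ℕ × ℕ) :
    (bchWord X Y e).map f = bchWord (f X) (f Y) e := by
  simp [bchWord, List.map_flatten, List.map_ofFn, Function.comp_def]

theorem length_bchWord {α : Type*} {m l : ℕ} (X Y : α) {e : Fin l → ℕ × ℕ}
    (he : e ∈ bchExponents m l) : (bchWord X Y e).length = m := by
  have h := (Finset.mem_filter.1 he).2.2
  rw [← h, bchWord, List.length_flatten, List.map_ofFn, List.sum_ofFn]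
  simp

theorem map_bchTerm {𝔥 : Type*} [LieRing 𝔥] [LieAlgebra k 𝔥] (f : 𝔤 →ₗ⁅k⁆ 𝔥) (m : ℕ) (X Y : 𝔤) :
    f (bchTerm k m X Y) = bchTerm k m (f X) (f Y) := by
  simp [bchTerm, map_sum, map_nestedBracket, map_bchWord]

end BCH

/-! ### The lattice, the Lie algebra and its quotients -/

/-- A skew-symmetric bilinear form `N × N → ℚ`. -/
structure SkewForm (N : Type*) [AddCommGroup N] where
  form : N →ₗ[ℤ] N →ₗ[ℤ] ℚ
  skew : ∀ x y, form x y = -form y x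

section Lattice

variable {N : Type*} [AddCommGroup N]

/-- `N⁺ = {a₁ e₁ + a₂ e₂ | a₁, a₂ ∈ ℤ_{≥ 0}, a₁ + a₂ > 0}`. -/
def NPlus (b : Module.Basis (Fin 2) ℤ N) : AddSubsemigroup N where
  carrier := {n | 0 ≤ b.repr n 0 ∧ 0 ≤ b.repr n 1 ∧ 0 < b.repr n 0 + b.repr n 1}
  add_mem' := by
    rintro x y ⟨h1, h2, h3⟩ ⟨h4, h5, h6⟩
    simp only [Set.mem_ofPred_eq, map_add, Finsupp.add_apply]
    refine ⟨by omega, by omega, by omega⟩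

variable {b : Module.Basis (Fin 2) ℤ N}

/-- `n + p m ∈ N⁺` for `n, m ∈ N⁺` and an integer `p ≥ 0`. -/
def NPlus.addMul (n : NPlus b) (p : ℕ) (m : NPlus b) : NPlus b :=
  ⟨(n : N) + p • (m : N), by
    induction p with
    | zero => simp
    | succ p ih =>
      rw [succ_nsmul, ← add_assoc]
      exact (NPlus b).add_mem ih m.2⟩

/-- `j n ∈ N⁺` for `n ∈ N⁺` and an integer `j > 0`. -/
def NPlus.mul (j : ℕ+) (n : NPlus b) : NPlus b :=
  ⟨(j : ℕ) • (n : N), by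
    obtain ⟨h1, h2, h3⟩ := n.2
    have hj : (0 : ℤ) < (j : ℕ) := by exact_mod_cast j.pos
    refine ⟨?_, ?_, ?_⟩
    · simpa using mul_nonneg hj.le h1
    · simpa using mul_nonneg hj.le h2
    · simpa [← mul_add] using mul_pos hj h3⟩

/-- The degree `a₁ + a₂` of `a₁ e₁ + a₂ e₂`. -/
noncomputable def NPlus.deg (n : NPlus b) : ℤ := b.repr (n : N) 0 + b.repr (n : N) 1

theorem NPlus.deg_pos (n : NPlus b) : 0 < NPlus.deg n := n.2.2.2

theorem NPlus.deg_add (n m : NPlus b) : NPlus.deg (n + m) = NPlus.deg n + NPlus.deg m := by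
  simp only [NPlus.deg, AddMemClass.coe_add, map_add, Finsupp.add_apply]
  ring

theorem NPlus.deg_mul (j : ℕ+) (n : NPlus b) :
    NPlus.deg (NPlus.mul j n) = (j : ℕ) * NPlus.deg n := by
  simp [NPlus.deg, NPlus.mul, mul_add]

/-- The set `ℒ` of the subsets `L ⊆ N⁺` with `N⁺ + L ⊆ L` and finite complement. -/
structure CofiniteIdeal (b : Module.Basis (Fin 2) ℤ N) where
  carrier : Set (NPlus b)
  add_mem : ∀ m : NPlus b, ∀ l ∈ carrier, m + l ∈ carrier
  finite_compl : carrierᶜ.Finite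

theorem CofiniteIdeal.exists_deg (L : CofiniteIdeal b) :
    ∃ M : ℕ, ∀ n : NPlus b, (M : ℤ) ≤ NPlus.deg n → n ∈ L.carrier := by
  obtain ⟨B, hB⟩ := (L.finite_compl.image fun n => NPlus.deg n).bddAbove
  refine ⟨(B + 1).toNat, fun n hn => ?_⟩
  by_contra h
  have h1 : NPlus.deg n ≤ B := hB ⟨n, h, rfl⟩
  omega

/-- The vector space `𝔤 = ⨁_{n ∈ N⁺} k X_n`; its Lie bracket, which depends on the form `ω`, is
given below. -/
@[nolint unusedArguments]
def TorusLie (k : Type*) [Field k] (b : Module.Basis (Fin 2) ℤ N) (_ω : SkewForm N) : Type _ :=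
  NPlus b →₀ k

namespace TorusLie

variable (k : Type*) [Field k] (b : Module.Basis (Fin 2) ℤ N) (ω : SkewForm N)

noncomputable instance : AddCommGroup (TorusLie k b ω) :=
  inferInstanceAs (AddCommGroup (NPlus b →₀ k))

noncomputable instance : Module k (TorusLie k b ω) :=
  inferInstanceAs (Module k (NPlus b →₀ k))

variable {b} in
/-- The generator `X_n`. -/
noncomputable def X (n : NPlus b) : TorusLie k b ω := Finsupp.single n (1 : k)

variable {k b ω} in
/-- The coefficient of `X_n`. -/
noncomputable def coeff (n : NPlus b) : TorusLie k b ω →ₗ[k] k := Finsupp.lapply n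

variable {k b ω} in
/-- The linear map out of `𝔤` with `X_n ↦ v n`. -/
noncomputable def lift {V : Type*} [AddCommGroup V] [Module k V] (v : NPlus b → V) :
    TorusLie k b ω →ₗ[k] V := Finsupp.linearCombination k v

variable {k b ω} in
theorem lift_X {V : Type*} [AddCommGroup V] [Module k V] (v : NPlus b → V) (n : NPlus b) :
    lift v (X k ω n) = v n :=
  (Finsupp.linearCombination_single k (1 : k) n).trans (one_smul k (v n))

variable {k b ω} in
theorem ext {x y : TorusLie k b ω} (h : ∀ n, coeff n x = coeff n y) : x = y := Finsupp.ext h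

variable {k b ω} in
theorem coeff_X (n m : NPlus b) [Decidable (m = n)] :
    coeff n (X k ω m) = if m = n then 1 else 0 := by
  classical
  refine (Finsupp.single_apply (a := m) (a' := n) (b := (1 : k))).trans ?_
  congr

variable {k b ω} in
/-- The bilinear map with `(X_n, X_{n'}) ↦ {n, n'} X_{n + n'}`. -/
noncomputable def bracketHom : TorusLie k b ω →ₗ[k] TorusLie k b ω →ₗ[k] TorusLie k b ω :=
  lift fun n => lift fun n' => ((ω.form (n : N) (n' : N) : ℚ) : k) • X k ω (n + n')

variable {k b ω} in
theorem bracketHom_X (n n' : NPlus b) : bracketHom (X k ω n) (X k ω n') =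
    ((ω.form (n : N) (n' : N) : ℚ) : k) • X k ω (n + n') := by
  rw [bracketHom, lift_X, lift_X]

variable {k b ω} in
theorem induction_X {p : TorusLie k b ω → Prop} (x : TorusLie k b ω) (h0 : p 0)
    (hadd : ∀ x y, p x → p y → p (x + y)) (hX : ∀ (a : k) n, p (a • X k ω n)) : p x := by
  refine Finsupp.induction_linear x h0 (fun x y => hadd x y) fun n a => ?_
  have h : a • X k ω n = Finsupp.single n a :=
    (Finsupp.smul_single a n (1 : k)).trans (by rw [smul_eq_mul, mul_one])
  exact h ▸ hX a n

variable {k b ω} in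
theorem bracketHom_skew (x y : TorusLie k b ω) : bracketHom x y = -bracketHom y x := by
  induction x using induction_X with
  | h0 => simp
  | hadd x x' hx hx' => rw [map_add, map_add, LinearMap.add_apply, hx, hx']; abel
  | hX s n =>
    induction y using induction_X with
    | h0 => simp
    | hadd y y' hy hy' => rw [map_add, map_add, LinearMap.add_apply, hy, hy']; abel
    | hX t m =>
      simp only [map_smul, LinearMap.smul_apply, bracketHom_X]
      rw [ω.skew n m, add_comm m n, smul_comm s t]
      simp

/-- The elements of `𝔤` supported in `S`. -/
noncomputable def supported (S : Set (NPlus b)) : Submodule k (TorusLie k b ω) where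
  carrier := {x | ∀ n, n ∉ S → coeff n x = 0}
  add_mem' hx hy n hn := by rw [map_add, hx n hn, hy n hn, add_zero]
  zero_mem' n _ := map_zero _
  smul_mem' a x hx n hn := by rw [map_smul, hx n hn, smul_zero]

variable {k b ω} in
theorem X_mem_supported {S : Set (NPlus b)} {n : NPlus b} (hn : n ∈ S) :
    X k ω n ∈ supported k b ω S := by
  classical
  intro m hm
  rw [coeff_X, if_neg]
  rintro rfl
  exact hm hn

variable {k b ω} in
theorem supported_induction {S : Set (NPlus b)} {p : TorusLie k b ω → Prop}
    {x : TorusLie k b ω} (hx : x ∈ supported k b ω S) (h0 : p 0)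
    (hadd : ∀ x y, p x → p y → p (x + y)) (hX : ∀ (a : k), ∀ n ∈ S, p (a • X k ω n)) : p x := by
  classical
  have key : ∀ y : TorusLie k b ω, p (lift (fun n => if n ∈ S then X k ω n else 0) y) := by
    intro y
    induction y using induction_X with
    | h0 => simpa using h0
    | hadd y y' h h' => simpa only [map_add] using hadd _ _ h h'
    | hX a n =>
      rw [map_smul, lift_X]
      split_ifs with h
      · exact hX a n h
      · simpa using h0
  have hc : ∀ (y : TorusLie k b ω) (n : NPlus b),
      coeff n (lift (fun n => if n ∈ S then X k ω n else 0) y)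
        = if n ∈ S then coeff n y else 0 := by
    intro y n
    induction y using induction_X with
    | h0 => simp
    | hadd y y' h h' =>
      simp only [map_add, h, h']
      split_ifs <;> simp
    | hX a m =>
      simp only [map_smul, lift_X]
      by_cases hm : m ∈ S <;> by_cases hn : n ∈ S <;> simp only [hm, hn, if_true, if_false,
        map_zero, smul_zero, coeff_X]
      · rw [if_neg (fun h' : m = n => hn (h' ▸ hm)), smul_zero]
      · rw [if_neg (fun h' : m = n => hm (h' ▸ hn)), smul_zero]
  have : lift (fun n => if n ∈ S then X k ω n else 0) x = x := by
    refine ext fun n => ?_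
    rw [hc]
    split_ifs with h
    · rfl
    · exact (hx n h).symm
  exact this ▸ key x

variable [CharZero k]

variable {k b ω} in
theorem bracketHom_jacobi (x y z : TorusLie k b ω) :
    bracketHom x (bracketHom y z) =
      bracketHom (bracketHom x y) z + bracketHom y (bracketHom x z) := by
  induction x using induction_X with
  | h0 => simp
  | hadd x x' hx hx' => simp only [map_add, LinearMap.add_apply, hx, hx']; abel
  | hX r l =>
    induction y using induction_X with
    | h0 => simp
    | hadd y y' hy hy' => simp only [map_add, LinearMap.add_apply, hy, hy']; abel
    | hX s n =>
      induction z using induction_X with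
      | h0 => simp
      | hadd z z' hz hz' => simp only [map_add, hz, hz']; abel
      | hX t m =>
        simp only [map_smul, LinearMap.smul_apply, bracketHom_X]
        rw [← add_assoc l n m, ← add_assoc n l m, add_comm n l]
        simp only [smul_smul, ← add_smul]
        congr 1
        simp only [AddMemClass.coe_add, map_add, LinearMap.add_apply, Rat.cast_add]
        rw [ω.skew n l]
        push_cast
        ring

/-- `𝔤` with `[X_n, X_{n'}] = {n, n'} X_{n + n'}`. -/
noncomputable instance : LieRing (TorusLie k b ω) where
  bracket x y := bracketHom x y
  add_lie x y z := by simp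
  lie_add x y z := by simp
  lie_self x := by
    have h : bracketHom x x = -bracketHom x x := bracketHom_skew x x
    have h2 : (2 : k) • bracketHom x x = 0 := by
      rw [two_smul]
      nth_rewrite 1 [h]
      exact neg_add_cancel _
    exact (smul_eq_zero.1 h2).resolve_left two_ne_zero
  leibniz_lie x y z := bracketHom_jacobi x y z

variable {k b ω} in
theorem lie_def (x y : TorusLie k b ω) : ⁅x, y⁆ = bracketHom x y := rfl

noncomputable instance : LieAlgebra k (TorusLie k b ω) where
  lie_smul t x y := by simp [lie_def]

variable {k b ω} in
theorem lie_mem_supported {S T U : Set (NPlus b)} (h : ∀ m ∈ S, ∀ n ∈ T, m + n ∈ U)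
    {x y : TorusLie k b ω} (hx : x ∈ supported k b ω S) (hy : y ∈ supported k b ω T) :
    ⁅x, y⁆ ∈ supported k b ω U := by
  refine supported_induction (p := fun x => ⁅x, y⁆ ∈ supported k b ω U) hx (by simp)
    (fun x x' h h' => by simpa only [add_lie] using add_mem h h') fun r m hm => ?_
  refine supported_induction (p := fun y => ⁅r • X k ω m, y⁆ ∈ supported k b ω U) hy (by simp)
    (fun y y' h h' => by simpa only [lie_add] using add_mem h h') fun s n hn => ?_
  rw [lie_def]
  simp only [map_smul, LinearMap.smul_apply, bracketHom_X]
  exact Submodule.smul_mem _ _ (Submodule.smul_mem _ _ (Submodule.smul_mem _ _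
    (X_mem_supported (h m hm n hn))))

variable {b} in
/-- The Lie ideal `𝔤^L = ⨁_{n ∈ L} k X_n`. -/
noncomputable def ideal (L : CofiniteIdeal b) : LieIdeal k (TorusLie k b ω) where
  toSubmodule := supported k b ω L.carrier
  lie_mem hy := lie_mem_supported (S := Set.univ) (fun m _ n hn => L.add_mem m n hn)
    (fun n hn => absurd (Set.mem_univ n) hn) hy

variable {k b ω} in
theorem nestedBracket_mem (a : TorusLie k b ω) (w : List (TorusLie k b ω)) :
    nestedBracket (a :: w) ∈
      supported k b ω {n : NPlus b | ((w.length + 1 : ℕ) : ℤ) ≤ NPlus.deg n} := by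
  have huniv : ∀ a : TorusLie k b ω, a ∈ supported k b ω {n : NPlus b | (1 : ℤ) ≤ NPlus.deg n} :=
    fun a n hn => absurd (NPlus.deg_pos n) hn
  induction w generalizing a with
  | nil => simpa [nestedBracket] using huniv a
  | cons c w ih =>
    refine lie_mem_supported (fun m hm n hn => ?_) (huniv a) (ih c)
    simp only [Set.mem_ofPred_eq, NPlus.deg_add, List.length_cons] at hm hn ⊢
    push_cast at hn ⊢
    linarith

end TorusLie

/-! ### The structure group -/

variable (k : Type*) [Field k] [CharZero k] {b : Module.Basis (Fin 2) ℤ N} (ω : SkewForm N)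

/-- The quotient Lie algebra `𝔤_L = 𝔤 / 𝔤^L`. -/
abbrev TorusLieMod (L : CofiniteIdeal b) : Type _ := TorusLie k b ω ⧸ TorusLie.ideal k ω L

namespace TorusLieMod

/-- The quotient map `𝔤 → 𝔤_L`. -/
noncomputable def mk (L : CofiniteIdeal b) : TorusLie k b ω →ₗ⁅k⁆ TorusLieMod k ω L :=
  { (TorusLie.ideal k ω L).toSubmodule.mkQ with
    map_lie' := fun {x y} => LieSubmodule.Quotient.mk_bracket _ x y }

variable {k ω} in
theorem mk_surjective (L : CofiniteIdeal b) : Function.Surjective (mk k ω L) :=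
  Submodule.mkQ_surjective _

variable {k ω} in
theorem mk_eq_zero {L : CofiniteIdeal b} {x : TorusLie k b ω} :
    mk k ω L x = 0 ↔ ∀ n, n ∉ L.carrier → TorusLie.coeff n x = 0 :=
  Submodule.Quotient.mk_eq_zero _

variable {k ω} in
theorem mk_X_eq_zero {L : CofiniteIdeal b} {n : NPlus b} (hn : n ∈ L.carrier) :
    mk k ω L (TorusLie.X k ω n) = 0 :=
  mk_eq_zero.2 (TorusLie.X_mem_supported hn)

/-- The canonical Lie algebra homomorphism `𝔤_L → 𝔤_{L'}` for `L ⊆ L'`. -/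
noncomputable def transition {L L' : CofiniteIdeal b} (h : L.carrier ⊆ L'.carrier) :
    TorusLieMod k ω L →ₗ⁅k⁆ TorusLieMod k ω L' :=
  { (TorusLie.ideal k ω L).toSubmodule.liftQ (mk k ω L' : TorusLie k b ω →ₗ[k] TorusLieMod k ω L')
      (fun _ hx => mk_eq_zero.2 fun n hn => hx n fun hL => hn (h hL)) with
    map_lie' := by
      intro x y
      obtain ⟨x, rfl⟩ := mk_surjective L x
      obtain ⟨y, rfl⟩ := mk_surjective L y
      rw [← LieHom.map_lie]
      exact LieHom.map_lie (mk k ω L') x y }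

variable {k ω} in
theorem transition_mk {L L' : CofiniteIdeal b} (h : L.carrier ⊆ L'.carrier)
    (x : TorusLie k b ω) : transition k ω h (mk k ω L x) = mk k ω L' x := rfl

variable {k ω} in
theorem exists_nestedBracket_eq_zero (L : CofiniteIdeal b) :
    ∃ M : ℕ, ∀ w : List (TorusLieMod k ω L), M ≤ w.length → nestedBracket w = 0 := by
  obtain ⟨M, hM⟩ := L.exists_deg
  refine ⟨M, fun w hw => ?_⟩
  obtain ⟨v, rfl⟩ := (mk_surjective (k := k) (ω := ω) L).list_map w
  rw [← map_nestedBracket]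
  cases v with
  | nil => simp [nestedBracket]
  | cons a v =>
    refine mk_eq_zero.2 fun n hn => TorusLie.nestedBracket_mem a v n fun h => hn (hM n ?_)
    simp only [List.length_map, List.length_cons] at hw
    have h' : ((v.length + 1 : ℕ) : ℤ) ≤ NPlus.deg n := h
    omega

variable {k ω} in
theorem finite_support_bchTerm {L : CofiniteIdeal b} (x y : TorusLieMod k ω L) :
    (Function.support fun m => bchTerm k m x y).Finite := by
  obtain ⟨M, hM⟩ := exists_nestedBracket_eq_zero (k := k) (ω := ω) L
  refine (Set.finite_lt_nat M).subset fun m hm => ?_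
  by_contra h
  refine hm (Finset.sum_eq_zero fun l _ => Finset.sum_eq_zero fun e he => ?_)
  rw [hM _ (by rw [length_bchWord _ _ he]; exact not_lt.1 h), smul_zero]

variable {k ω} in
theorem transition_bch {L L' : CofiniteIdeal b} (h : L.carrier ⊆ L'.carrier)
    (x y : TorusLieMod k ω L) :
    transition k ω h (bch k x y) = bch k (transition k ω h x) (transition k ω h y) := by
  unfold bch
  rw [map_finsum _ (finite_support_bchTerm x y)]
  simp only [map_bchTerm]

end TorusLieMod

/-- The set `G_L`, with the bijection `exp_L : 𝔤_L → G_L`. -/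
@[ext]
structure StructureGroupMod (L : CofiniteIdeal b) where
  /-- The bijection `exp_L`. -/
  exp ::
  /-- The inverse of `exp_L`. -/
  log : TorusLieMod k ω L

namespace StructureGroupMod

variable {k ω} {L : CofiniteIdeal b}

/-- `exp_L(X) exp_L(Y) = exp_L(X + Y + [X, Y]/2 + ⋯)`. -/
noncomputable instance : Mul (StructureGroupMod k ω L) := ⟨fun g h => exp (bch k g.log h.log)⟩

noncomputable instance : One (StructureGroupMod k ω L) := ⟨exp 0⟩

/-- The map `G_L → G_{L'}` for `L ⊆ L'`. -/
noncomputable def transition {L L' : CofiniteIdeal b} (h : L.carrier ⊆ L'.carrier)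
    (g : StructureGroupMod k ω L) : StructureGroupMod k ω L' :=
  exp (TorusLieMod.transition k ω h g.log)

theorem transition_mul {L L' : CofiniteIdeal b} (h : L.carrier ⊆ L'.carrier)
    (g g' : StructureGroupMod k ω L) :
    transition h (g * g') = transition h g * transition h g' :=
  congrArg exp (TorusLieMod.transition_bch h g.log g'.log)

theorem transition_one {L L' : CofiniteIdeal b} (h : L.carrier ⊆ L'.carrier) :
    transition h (1 : StructureGroupMod k ω L) = 1 :=
  congrArg exp (map_zero (TorusLieMod.transition k ω h))

end StructureGroupMod

variable (b) in
/-- The inverse limit `ĝ` of the Lie algebras `𝔤_L`. -/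
noncomputable def CompletedLie : Submodule k (∀ L : CofiniteIdeal b, TorusLieMod k ω L) where
  carrier := {x | ∀ (L L' : CofiniteIdeal b) (h : L.carrier ⊆ L'.carrier),
    TorusLieMod.transition k ω h (x L) = x L'}
  add_mem' hx hy L L' h := by simp [hx L L' h, hy L L' h]
  zero_mem' L L' h := by simp
  smul_mem' a x hx L L' h := by simp [hx L L' h]

noncomputable instance : LieRing (CompletedLie k b ω) where
  bracket x y := ⟨fun L => ⁅x.1 L, y.1 L⁆, fun L L' h => by
    rw [LieHom.map_lie, x.2 L L' h, y.2 L L' h]⟩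
  add_lie x y z := Subtype.ext (funext fun L => add_lie (x.1 L) (y.1 L) (z.1 L))
  lie_add x y z := Subtype.ext (funext fun L => lie_add (x.1 L) (y.1 L) (z.1 L))
  lie_self x := Subtype.ext (funext fun L => lie_self (x.1 L))
  leibniz_lie x y z := Subtype.ext (funext fun L => leibniz_lie (x.1 L) (y.1 L) (z.1 L))

noncomputable instance : LieAlgebra k (CompletedLie k b ω) where
  lie_smul t x y := Subtype.ext (funext fun L => lie_smul t (x.1 L) (y.1 L))

variable (b) in
/-- The structure group `G`, the inverse limit of the groups `G_L`. -/
def StructureGroup : Type _ :=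
  {g : ∀ L : CofiniteIdeal b, StructureGroupMod k ω L //
    ∀ (L L' : CofiniteIdeal b) (h : L.carrier ⊆ L'.carrier),
      StructureGroupMod.transition h (g L) = g L'}

namespace StructureGroup

variable {k ω}

/-- The image of an element of `G` in `G_L`. -/
def proj (L : CofiniteIdeal b) (g : StructureGroup k b ω) : StructureGroupMod k ω L := g.1 L

noncomputable instance : Mul (StructureGroup k b ω) :=
  ⟨fun g g' => ⟨fun L => g.1 L * g'.1 L, fun L L' h => by
    rw [StructureGroupMod.transition_mul, g.2 L L' h, g'.2 L L' h]⟩⟩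

noncomputable instance : One (StructureGroup k b ω) :=
  ⟨⟨fun _ => 1, fun _ _ h => StructureGroupMod.transition_one h⟩⟩

/-- The bijection `exp : ĝ → G`. -/
noncomputable def exp : CompletedLie k b ω ≃ StructureGroup k b ω where
  toFun x := ⟨fun L => StructureGroupMod.exp (x.1 L),
    fun L L' h => congrArg StructureGroupMod.exp (x.2 L L' h)⟩
  invFun g := ⟨fun L => (g.1 L).log, fun L L' h => congrArg StructureGroupMod.log (g.2 L L' h)⟩
  left_inv _ := rfl
  right_inv _ := rfl

/-- `g ^ c = exp (c X)` for `g = exp X` and `c ∈ ℚ`. -/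
noncomputable instance : Pow (StructureGroup k b ω) ℚ :=
  ⟨fun g c => exp ((c : k) • exp.symm g)⟩

end StructureGroup

variable {k} in
theorem finite_support_dilogTerm (a : ℕ+ → k) (L : CofiniteIdeal b) (n : NPlus b) :
    (Function.support fun j : ℕ+ =>
      a j • TorusLieMod.mk k ω L (TorusLie.X k ω (NPlus.mul j n))).Finite := by
  obtain ⟨M, hM⟩ := L.exists_deg
  refine (Set.finite_lt_nat M).preimage PNat.coe_injective.injOn |>.subset fun j hj => ?_
  by_contra h
  refine hj ?_
  have h' : M ≤ (j : ℕ) := not_lt.1 h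
  have hn := NPlus.deg_pos n
  dsimp only
  rw [TorusLieMod.mk_X_eq_zero (hM _ _), smul_zero]
  rw [NPlus.deg_mul]
  nlinarith [(by exact_mod_cast h' : (M : ℤ) ≤ (j : ℕ))]

/-- `∑_{j > 0} (-1)^(j+1)/j² X_{jn} ∈ ĝ`; the sum is finite in every `𝔤_L`. -/
noncomputable def dilogLie (n : NPlus b) : CompletedLie k b ω :=
  ⟨fun L => ∑ᶠ j : ℕ+, ((-1 : k) ^ ((j : ℕ) + 1) / ((j : ℕ) : k) ^ 2) •
      TorusLieMod.mk k ω L (TorusLie.X k ω (NPlus.mul j n)), by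
    intro L L' h
    rw [map_finsum _ (finite_support_dilogTerm ω _ L n)]
    simp only [map_smul, TorusLieMod.transition_mk]⟩

/-- The dilogarithm element `[n] = exp (∑_{j > 0} (-1)^(j+1)/j² X_{jn})`. -/
noncomputable def dilog (n : NPlus b) : StructureGroup k b ω := StructureGroup.exp (dilogLie k ω n)

/-! ### Infinite products in the structure group -/

namespace StructureGroup

variable {k ω}

/-- `g = a₀ a₁ a₂ ⋯`: in every `G_L`, the partial products `a₀ a₁ ⋯ a_{m-1}` are eventually
equal to `g`. -/
def IsProdRight (a : ℕ → StructureGroup k b ω) (g : StructureGroup k b ω) : Prop :=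
  ∀ L : CofiniteIdeal b, ∀ᶠ m in Filter.atTop, proj L ((List.range m).map a).prod = proj L g

/-- `g = ⋯ a₂ a₁ a₀`: in every `G_L`, the partial products `a_{m-1} ⋯ a₁ a₀` are eventually
equal to `g`. -/
def IsProdLeft (a : ℕ → StructureGroup k b ω) (g : StructureGroup k b ω) : Prop :=
  ∀ L : CofiniteIdeal b, ∀ᶠ m in Filter.atTop,
    proj L ((List.range m).reverse.map a).prod = proj L g

/-- `g = ∏_{p ≥ 0} a_p`, with the factors multiplied in any order: in every `G_L`, all the finite
products over distinct indices, in any order, that contain a certain finite set of indices are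
equal to `g`. -/
def IsProd (a : ℕ → StructureGroup k b ω) (g : StructureGroup k b ω) : Prop :=
  ∀ L : CofiniteIdeal b, ∃ F : Finset ℕ, ∀ l : List ℕ, l.Nodup → (∀ p ∈ F, p ∈ l) →
    proj L (l.map a).prod = proj L g

end StructureGroup

end Lattice

/-!
The group `G_L` acts faithfully on a space of functions, and the identity is checked there.

*The action.* `X_n` acts on the functions on `N⁺ ∪ {0}` that vanish on `L` by
`f ↦ ({·, n} + deg n) f (· + n)`; this is a nilpotent and faithful representation of `𝔤_L`
(`torusModRep_injective`). Exponentiating it gives an injective map on `G_L`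
(`StructureGroupMod.rep_injective`), which is multiplicative by the Baker-Campbell-Hausdorff formula
(`StructureGroupMod.rep_mul`).

*The Baker-Campbell-Hausdorff formula in Dynkin's form* (`exp_sum_bchTerm`). Let `Z` be the
logarithm of `e^X e^Y` in an associative algebra, computed by expanding the series `log (1 + u)` in words.
Conjugation by `e^X e^Y = e^Z` gives `e^{ad X} e^{ad Y} = e^{ad Z}`; taking logarithms, `ad Z` is
obtained from `Z` by replacing each letter `a` of each word by `ad a`. Suppose that `[X, H] = X` and
`[Y, H] = Y`, and apply this to `H`: a word `a₁ ⋯ aₘ` becomes the nested bracket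
`[a₁, [⋯, [aₘ₋₁, aₘ]]]` on one side and `m a₁ ⋯ aₘ` on the other. Such an `H` exists after the
algebra is made to act on sequences, with `X` and `Y` shifting them by one.

*The pentagon relation* `[n']^c [n]^c = [n]^c [n + n']^c [n']^c` for `{n', n} = 1/c`
(`dilogOp_pentagon`). The operator of `[n]^c` is a binomial series in the shift by `n`
(`dilogOp_apply`), so that the relation becomes an identity between sums of products of binomial
coefficients (`mixedCoeff_eq`). It says which coefficients the series
`(1 + x)^γ (1 + y)^δ / (1 - x y)^(γ + δ + 1)` has, and it follows from Pascal's rule for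
`γ, δ ∈ ℕ`, hence for all `γ, δ` since both sides are polynomials.

*The factorization* (`dilogOp_factorization`). With `m = n + n'`, three pentagons give
`[n']^{2c} [n]^{2c} = [n]^{2c} [n + m]^c [m]^{2c} ([n']^c [n + m]^c) [m]^{2c} [n']^c`.
The product in parentheses has the same shape as the left-hand side, with `n + m`, `n'`, `c / 2` in
the place of `n`, `n'`, `c`; as `n` has been replaced by a vector of larger degree and large degrees
are invisible in `G_L`, induction applies and factors it. Its rays consist of every other vector of
the two rays wanted, and the pentagon relation, used to move the two factors `[m]^{2c}` to the
center, inserts the missing vectors.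
-/

/-! ### Exponential and logarithm of nilpotent elements -/

section NilpotentLog

open Polynomial Finset

theorem succ_mul_choose_succ (α : ℚ) (i : ℕ) :
    ((i : ℚ) + 1) * Ring.choose α (i + 1) = (α - i) * Ring.choose α i := by
  have h := Ring.choose_smul_choose α (Nat.le_succ i)
  rw [Nat.succ_sub (le_refl i), Nat.sub_self, Ring.choose_one_right, Nat.choose_succ_self_right,
    nsmul_eq_mul] at h
  push_cast at h
  rw [h, mul_comm]

/-- The truncation of the power series `log (1 + X)` at degree `K`. The term with `l = 0` vanishes
by the convention `x / 0 = 0`. -/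
noncomputable def logPoly (K : ℕ) : ℚ[X] :=
  ∑ l ∈ range K, C ((-1 : ℚ) ^ (l + 1) / l) * X ^ l

theorem one_add_X_mul_derivative_logPoly (K : ℕ) :
    (1 + X) * derivative (logPoly (K + 1)) = 1 - (-X : ℚ[X]) ^ K := by
  induction K with
  | zero => simp [logPoly]
  | succ K ih =>
    rw [logPoly, sum_range_succ, ← logPoly, derivative_add, mul_add, ih]
    have hK : ((K : ℚ) + 1) ≠ 0 := by positivity
    have : derivative (C ((-1 : ℚ) ^ (K + 1 + 1) / ((K + 1 : ℕ) : ℚ)) * X ^ (K + 1)) =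
        (-X : ℚ[X]) ^ K := by
      rw [derivative_C_mul_X_pow, neg_pow (X : ℚ[X]) K]
      push_cast
      rw [div_mul_cancel₀ _ hK, pow_add, pow_add]
      simp
    rw [this]
    ring

theorem X_dvd_logPoly (K : ℕ) : X ∣ logPoly K := by
  refine dvd_sum fun l _ => ?_
  cases l with
  | zero => simp
  | succ l => exact dvd_mul_of_dvd_right (dvd_pow_self _ l.succ_ne_zero) _

theorem derivative_sum_pow_div_factorial (K : ℕ) (p : ℚ[X]) :
    derivative (∑ j ∈ range (K + 1), C ((j.factorial : ℚ)⁻¹) * p ^ j) =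
      derivative p * ∑ j ∈ range K, C ((j.factorial : ℚ)⁻¹) * p ^ j := by
  rw [sum_range_succ', derivative_add, derivative_sum, mul_sum]
  simp only [pow_zero, mul_one, derivative_C, add_zero]
  refine sum_congr rfl fun j _ => ?_
  rw [derivative_C_mul, derivative_pow_succ, Nat.factorial_succ]
  have h : C (((((j + 1) * j.factorial : ℕ)) : ℚ)⁻¹) * C ((j : ℚ) + 1) =
      C ((j.factorial : ℚ)⁻¹) := by
    rw [← C_mul]
    congr 1
    have : ((j : ℚ) + 1) ≠ 0 := by positivity
    have : (j.factorial : ℚ) ≠ 0 := by positivity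
    push_cast
    field_simp
  rw [← h]
  ring

/-- The coefficients of `exp (α log (1 + X))` are the binomial coefficients of `α`, since this
series `f` satisfies `(1 + X) f' = α f`. -/
theorem coeff_exp_logPoly (α : ℚ) (K i : ℕ) (hi : i ≤ K) :
    (∑ j ∈ range (K + 1), C ((j.factorial : ℚ)⁻¹) * (C α * logPoly (K + 1)) ^ j).coeff i =
      Ring.choose α i := by
  set p := C α * logPoly (K + 1) with hp
  set P := ∑ j ∈ range (K + 1), C ((j.factorial : ℚ)⁻¹) * p ^ j with hP
  have hXp : X ∣ p := dvd_mul_of_dvd_right (X_dvd_logPoly _) _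
  have hdvd : X ^ K ∣ (1 + X) * derivative P - C α * P := by
    have h1 : (1 + X) * derivative P - C α * P =
        X ^ K * (-C α * (-1) ^ K * ∑ j ∈ range K, C ((j.factorial : ℚ)⁻¹) * p ^ j)
          - p ^ K * (C α * C ((K.factorial : ℚ)⁻¹)) := by
      have h2 := one_add_X_mul_derivative_logPoly K
      rw [hP, derivative_sum_pow_div_factorial, sum_range_succ, hp, derivative_C_mul, ← hp]
      rw [neg_pow] at h2
      linear_combination (C α * ∑ j ∈ range K, C ((j.factorial : ℚ)⁻¹) * p ^ j) * h2
    rw [h1]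
    exact dvd_sub (dvd_mul_right _ _) (dvd_mul_of_dvd_left (pow_dvd_pow_of_dvd hXp K) _)
  rw [X_pow_dvd_iff] at hdvd
  induction i with
  | zero =>
    rw [hP, sum_range_succ', coeff_add, finsetSum_coeff, sum_eq_zero]
    · simp
    · intro j _
      have : X ∣ C (((j + 1).factorial : ℚ)⁻¹) * p ^ (j + 1) :=
        dvd_mul_of_dvd_right (hXp.trans (dvd_pow_self _ j.succ_ne_zero)) _
      exact X_dvd_iff.1 this
  | succ i ih =>
    have h1 := hdvd i (by omega)
    have h2 := ih (by omega)
    have h3 : (X * derivative P).coeff i = i * P.coeff i := by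
      cases i with
      | zero => simp
      | succ i => rw [coeff_X_mul, coeff_derivative]; push_cast; ring
    rw [coeff_sub, add_mul, one_mul, coeff_add, h3, coeff_derivative, coeff_C_mul, h2] at h1
    have h4 := succ_mul_choose_succ α i
    have : ((i : ℚ) + 1) ≠ 0 := by positivity
    refine mul_left_cancel₀ this ?_
    linear_combination h1 - h4

variable {A : Type*} [Ring A] [Algebra ℚ A]

/-- `log (1 + a) = ∑_{l > 0} (-1)^(l+1)/l a^l` for a nilpotent element `a`. -/
noncomputable def nilLog (a : A) : A :=
  ∑ l ∈ range (nilpotencyClass a), ((-1 : ℚ) ^ (l + 1) / l) • a ^ l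

theorem nilLog_eq_sum {a : A} {K : ℕ} (h : a ^ K = 0) :
    nilLog a = ∑ l ∈ range K, ((-1 : ℚ) ^ (l + 1) / l) • a ^ l := by
  refine sum_subset (range_mono (csInf_le' h)) fun l _ hl => ?_
  rw [pow_eq_zero_of_le (not_lt.1 fun h' => hl (mem_range.2 h')) (pow_nilpotencyClass ⟨K, h⟩),
    smul_zero]

theorem nilLog_eq_aeval {a : A} {K : ℕ} (h : a ^ K = 0) : nilLog a = aeval a (logPoly K) := by
  simp [nilLog_eq_sum h, logPoly, map_sum, Algebra.smul_def]

theorem isNilpotent_nilLog {a : A} (ha : IsNilpotent a) : IsNilpotent (nilLog a) := by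
  obtain ⟨K, hK⟩ := ha
  obtain ⟨q, hq⟩ := X_dvd_logPoly K
  refine ⟨K, ?_⟩
  rw [nilLog_eq_aeval hK, hq, map_mul, aeval_X, Commute.mul_pow, hK, zero_mul]
  exact (Commute.all X q).map (aeval a) |> fun h => by simpa using h

theorem nilLog_commute {a b : A} (h : Commute a b) : Commute (nilLog a) b :=
  Commute.sum_left _ _ _ fun _ _ => (h.pow_left _).smul_left _

theorem aeval_eq_sum_of_pow_eq_zero {a : A} {K : ℕ} (h : a ^ K = 0) (p : ℚ[X]) :
    aeval a p = ∑ i ∈ range K, p.coeff i • a ^ i := by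
  rw [aeval_eq_sum_range' (n := max K (p.natDegree + 1)) (by omega)]
  symm
  refine sum_subset (range_mono (le_max_left _ _)) fun l _ hl => ?_
  rw [pow_eq_zero_of_le (not_lt.1 fun h' => hl (mem_range.2 h')) h, smul_zero]

/-- `(1 + a)^α = ∑ᵢ (α choose i) aⁱ`. -/
theorem exp_smul_nilLog {a : A} {K : ℕ} (h : a ^ K = 0) (α : ℚ) :
    IsNilpotent.exp (α • nilLog a) = ∑ i ∈ range K, Ring.choose α i • a ^ i := by
  cases K with
  | zero =>
    have : Subsingleton A := subsingleton_of_zero_eq_one (by simpa using h.symm)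
    exact Subsingleton.elim _ _
  | succ K =>
    have h1 : (α • nilLog a) ^ (K + 1) = 0 := by
      obtain ⟨q, hq⟩ := X_dvd_logPoly (K + 1)
      rw [_root_.smul_pow, nilLog_eq_aeval h, hq, map_mul, aeval_X, Commute.mul_pow, h, zero_mul,
        smul_zero]
      exact (Commute.all X q).map (aeval a) |> fun h => by simpa using h
    rw [IsNilpotent.exp_eq_sum h1]
    trans aeval a (∑ j ∈ range (K + 1), C ((j.factorial : ℚ)⁻¹) * (C α * logPoly (K + 1)) ^ j)
    · rw [map_sum]
      refine sum_congr rfl fun j _ => ?_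
      rw [nilLog_eq_aeval h]
      simp [Algebra.smul_def]
    · rw [aeval_eq_sum_of_pow_eq_zero h]
      refine sum_congr rfl fun i hi => ?_
      rw [coeff_exp_logPoly _ _ _ (Nat.lt_succ_iff.1 (mem_range.1 hi))]

theorem exp_nilLog {a : A} (ha : IsNilpotent a) : IsNilpotent.exp (nilLog a) = 1 + a := by
  obtain ⟨K, hK⟩ := ha
  have hK2 : a ^ (K + 2) = 0 := by rw [pow_add, hK, zero_mul]
  have h := exp_smul_nilLog hK2 1
  rw [one_smul] at h
  rw [h, sum_range_succ', sum_range_succ', sum_eq_zero]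
  · simp [add_comm]
  · intro i _
    have : Ring.choose (1 : ℚ) (i + 1 + 1) = 0 := by
      have := Ring.choose_natCast (R := ℚ) 1 (i + 1 + 1)
      rw [Nat.choose_eq_zero_of_lt (by omega)] at this
      simpa using this
    rw [this, zero_smul]

/-- `exp a - 1` is the product of `a` and a unit `1 + a/2 + ⋯`. -/
theorem eq_zero_of_exp_eq_one {a : A} (ha : IsNilpotent a) (h : IsNilpotent.exp a = 1) :
    a = 0 := by
  obtain ⟨K, hK⟩ := ha
  have hK2 : a ^ (K + 2) = 0 := by rw [pow_add, hK, zero_mul]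
  have h1 : ((1 : A) + a * ∑ j ∈ range K, ((j + 2).factorial : ℚ)⁻¹ • a ^ j) * a = 0 := by
    rw [IsNilpotent.exp_eq_sum hK2, sum_range_succ', sum_range_succ'] at h
    have h2 : ∑ j ∈ range K, ((j + 1 + 1).factorial : ℚ)⁻¹ • a ^ (j + 1 + 1) + a = 0 := by
      simpa using h
    rw [add_mul, one_mul, mul_sum, sum_mul, add_comm, ← h2]
    congr 1
    refine sum_congr rfl fun j _ => ?_
    rw [mul_smul_comm, smul_mul_assoc, ← pow_succ', ← pow_succ]
  have hc : Commute a (∑ j ∈ range K, ((j + 2).factorial : ℚ)⁻¹ • a ^ j) :=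
    Commute.sum_right _ _ _ fun j _ => ((Commute.refl a).pow_right j).smul_right _
  have hu : IsUnit ((1 : A) + a * ∑ j ∈ range K, ((j + 2).factorial : ℚ)⁻¹ • a ^ j) :=
    (hc.isNilpotent_mul_right ⟨K, hK⟩).isUnit_one_add
  exact hu.mul_right_eq_zero.1 h1

theorem isNilpotent_exp_sub_one {a : A} (ha : IsNilpotent a) :
    IsNilpotent (IsNilpotent.exp a - 1) := by
  obtain ⟨K, hK⟩ := ha
  have hK2 : a ^ (K + 1) = 0 := by rw [pow_succ, hK, zero_mul]
  rw [IsNilpotent.exp_eq_sum hK2, sum_range_succ']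
  have : ∑ j ∈ range K, ((j + 1).factorial : ℚ)⁻¹ • a ^ (j + 1) =
      a * ∑ j ∈ range K, ((j + 1).factorial : ℚ)⁻¹ • a ^ j := by
    rw [mul_sum]
    exact sum_congr rfl fun j _ => by rw [mul_smul_comm, pow_succ']
  simp only [Nat.factorial_zero, Nat.cast_one, inv_one, pow_zero, one_smul, add_sub_cancel_right]
  rw [this]
  have hc : Commute a (∑ j ∈ range K, ((j + 1).factorial : ℚ)⁻¹ • a ^ j) :=
    Commute.sum_right _ _ _ fun j _ => ((Commute.refl a).pow_right j).smul_right _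
  exact hc.isNilpotent_mul_right ⟨K, hK⟩

/-- `log (exp a)` commutes with `a` and has the same exponential. -/
theorem nilLog_exp_sub_one {a : A} (ha : IsNilpotent a) :
    nilLog (IsNilpotent.exp a - 1) = a := by
  have hn := isNilpotent_exp_sub_one ha
  have h1 := exp_nilLog hn
  set b := nilLog (IsNilpotent.exp a - 1) with hb
  have hc : Commute b a := by
    refine nilLog_commute (Commute.sub_left ?_ (Commute.one_left a))
    exact Commute.sum_left _ _ _ fun _ _ => ((Commute.refl a).pow_left _).smul_left _
  have hbn : IsNilpotent b := isNilpotent_nilLog hn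
  have h2 : IsNilpotent.exp (b + -a) = 1 := by
    rw [IsNilpotent.exp_add_of_commute hc.neg_right hbn ha.neg, h1, add_sub_cancel,
      IsNilpotent.exp_mul_exp_neg_self ha]
  have h3 := eq_zero_of_exp_eq_one (hc.neg_right.isNilpotent_add hbn ha.neg) h2
  rwa [← sub_eq_add_neg, sub_eq_zero] at h3

theorem exp_injective_of_isNilpotent {a b : A} (ha : IsNilpotent a) (hb : IsNilpotent b)
    (h : IsNilpotent.exp a = IsNilpotent.exp b) : a = b := by
  rw [← nilLog_exp_sub_one ha, h, nilLog_exp_sub_one hb]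

end NilpotentLog

/-! ### The Baker-Campbell-Hausdorff formula in Dynkin's form -/

section DynkinFormula

attribute [local instance] LieRing.ofAssociativeRing

open Finset

/-- All products of at least `M` factors, each of them equal to `X` or `Y`, vanish. -/
def JointlyNilpotent {A : Type*} [Ring A] (M : ℕ) (X Y : A) : Prop :=
  ∀ w : List A, (∀ a ∈ w, a = X ∨ a = Y) → M ≤ w.length → w.prod = 0

section

variable {A : Type*} [Ring A]

theorem JointlyNilpotent.mono {M M' : ℕ} {X Y : A} (h : JointlyNilpotent M X Y) (hM : M ≤ M') :
    JointlyNilpotent M' X Y :=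
  fun w hw hl => h w hw (hM.trans hl)

theorem JointlyNilpotent.pow_left {M : ℕ} {X Y : A} (h : JointlyNilpotent M X Y) : X ^ M = 0 := by
  have := h (List.replicate M X) (fun a ha => Or.inl (List.eq_of_mem_replicate ha)) (by simp)
  simpa using this

theorem JointlyNilpotent.pow_right {M : ℕ} {X Y : A} (h : JointlyNilpotent M X Y) :
    Y ^ M = 0 := by
  have := h (List.replicate M Y) (fun a ha => Or.inr (List.eq_of_mem_replicate ha)) (by simp)
  simpa using this

theorem mem_bchWord {α : Type*} {l : ℕ} {X Y a : α} {e : Fin l → ℕ × ℕ}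
    (ha : a ∈ bchWord X Y e) : a = X ∨ a = Y := by
  simp only [bchWord, List.mem_flatten, List.mem_ofFn] at ha
  obtain ⟨w, ⟨i, rfl⟩, hw⟩ := ha
  rw [List.mem_append] at hw
  exact hw.imp List.eq_of_mem_replicate List.eq_of_mem_replicate

theorem length_bchWord_eq_sum {α : Type*} {l : ℕ} (X Y : α) (e : Fin l → ℕ × ℕ) :
    (bchWord X Y e).length = ∑ i, ((e i).1 + (e i).2) := by
  rw [bchWord, List.length_flatten, List.map_ofFn, List.sum_ofFn]
  simp

theorem prod_bchWord {l : ℕ} (X Y : A) (e : Fin l → ℕ × ℕ) :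
    (bchWord X Y e).prod = (List.ofFn fun i => X ^ (e i).1 * Y ^ (e i).2).prod := by
  rw [bchWord, List.prod_flatten, List.map_ofFn]
  congr 2
  ext i
  simp

theorem prod_bchWord_eq_zero {K l : ℕ} {X Y : A} (h : JointlyNilpotent K X Y)
    {e : Fin l → ℕ × ℕ} (he : K ≤ ∑ i, ((e i).1 + (e i).2)) : (bchWord X Y e).prod = 0 :=
  h _ (fun _ => mem_bchWord) (by rwa [length_bchWord_eq_sum])

theorem sum_pow_eq_sum_piFinset {ι : Type*} [DecidableEq ι] (s : Finset ι) (g : ι → A) (l : ℕ) :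
    (∑ a ∈ s, g a) ^ l =
      ∑ e ∈ Fintype.piFinset (fun _ : Fin l => s), (List.ofFn fun i => g (e i)).prod := by
  induction l with
  | zero => simp
  | succ l ih =>
    rw [pow_succ', ih, sum_mul_sum, ← sum_product']
    refine sum_bij' (fun p _ => Fin.cons p.1 p.2) (fun e _ => (e 0, Fin.tail e)) ?_ ?_ ?_ ?_ ?_
    · intro p hp
      rw [mem_product] at hp
      rw [Fintype.mem_piFinset] at hp ⊢
      refine Fin.cases ?_ fun i => ?_
      · simpa using hp.1
      · simpa using hp.2 i
    · intro e he
      rw [Fintype.mem_piFinset] at he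
      rw [mem_product, Fintype.mem_piFinset]
      exact ⟨he 0, fun i => he i.succ⟩
    · intro p _
      simp
    · intro e _
      exact Fin.cons_self_tail e
    · intro p _
      simp [List.ofFn_succ]

theorem prod_ofFn_smul [Algebra ℚ A] {l : ℕ} (c : Fin l → ℚ) (g : Fin l → A) :
    (List.ofFn fun i => c i • g i).prod = (∏ i, c i) • (List.ofFn g).prod := by
  induction l with
  | zero => simp
  | succ l ih =>
    rw [List.ofFn_succ, List.ofFn_succ, List.prod_cons, List.prod_cons, Fin.prod_univ_succ, ih,
      smul_mul_smul_comm]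

variable [Algebra ℚ A]

/-- The part of degree `m` of `log (e^X e^Y)`, expanded in words in the associative algebra `A`. -/
noncomputable def logTerm (m : ℕ) (X Y : A) : A :=
  ∑ l ∈ Icc 1 m, ∑ e ∈ bchExponents m l,
    ((-1 : ℚ) ^ (l + 1) / ((l : ℚ) *
      ∏ i, (((e i).1.factorial : ℚ) * ((e i).2.factorial : ℚ)))) • (bchWord X Y e).prod

theorem bchExponents_eq_empty {m l : ℕ} (h : m < l) : bchExponents m l = ∅ := by
  refine filter_eq_empty_iff.2 fun e _ he => ?_
  have : ∑ _i : Fin l, 1 ≤ ∑ i, ((e i).1 + (e i).2) := sum_le_sum fun i _ => he.1 i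
  rw [he.2] at this
  simp at this
  omega

/-- The nonzero pairs `(r, s)` with `r, s < K`. -/
def posPairs (K : ℕ) : Finset (ℕ × ℕ) := (range K ×ˢ range K).filter fun a => 0 < a.1 + a.2

theorem bchExponents_eq_filter {m K : ℕ} (h : m < K) (l : ℕ) :
    bchExponents m l = (Fintype.piFinset fun _ : Fin l => posPairs K).filter
      fun e => ∑ i, ((e i).1 + (e i).2) = m := by
  ext e
  simp only [bchExponents, posPairs, mem_filter, Fintype.mem_piFinset, mem_product, mem_range]
  constructor
  · rintro ⟨h1, h2, h3⟩
    exact ⟨fun i => ⟨⟨by have := (h1 i).1; omega, by have := (h1 i).2; omega⟩, h2 i⟩, h3⟩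
  · rintro ⟨h1, h3⟩
    refine ⟨fun i => ?_, fun i => (h1 i).2, h3⟩
    have : (e i).1 + (e i).2 ≤ ∑ i, ((e i).1 + (e i).2) :=
      single_le_sum (f := fun i => (e i).1 + (e i).2) (fun _ _ => Nat.zero_le _) (mem_univ i)
    omega

theorem exp_mul_exp_sub_one {K : ℕ} {X Y : A} (hX : X ^ (K + 1) = 0) (hY : Y ^ (K + 1) = 0) :
    IsNilpotent.exp X * IsNilpotent.exp Y - 1 =
      ∑ a ∈ posPairs (K + 1),
        ((a.1.factorial : ℚ) * (a.2.factorial : ℚ))⁻¹ • (X ^ a.1 * Y ^ a.2) := by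
  rw [IsNilpotent.exp_eq_sum hX, IsNilpotent.exp_eq_sum hY, sum_mul_sum, ← sum_product']
  rw [← sum_filter_add_sum_filter_not _ (fun a : ℕ × ℕ => 0 < a.1 + a.2)]
  have : (range (K + 1) ×ˢ range (K + 1)).filter (fun a : ℕ × ℕ => ¬ 0 < a.1 + a.2) = {(0, 0)} := by
    ext ⟨a, b⟩
    simp only [mem_filter, mem_product, mem_range, mem_singleton, Prod.mk.injEq]
    omega
  rw [this, sum_singleton]
  simp only [Nat.factorial_zero, Nat.cast_one, inv_one, pow_zero, one_smul, mul_one,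
    add_sub_cancel_right]
  refine sum_congr rfl fun a _ => ?_
  rw [smul_mul_smul_comm, mul_inv]

theorem exp_mul_exp_sub_one_pow {K : ℕ} {X Y : A} (h : JointlyNilpotent (K + 1) X Y) (l : ℕ) :
    (IsNilpotent.exp X * IsNilpotent.exp Y - 1) ^ l =
      ∑ e ∈ Fintype.piFinset (fun _ : Fin l => posPairs (K + 1)),
        (∏ i, (((e i).1.factorial : ℚ) * ((e i).2.factorial : ℚ)))⁻¹ • (bchWord X Y e).prod := by
  rw [exp_mul_exp_sub_one h.pow_left h.pow_right, sum_pow_eq_sum_piFinset]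
  refine sum_congr rfl fun e _ => ?_
  rw [prod_ofFn_smul, prod_bchWord, prod_inv_distrib]

theorem exp_mul_exp_sub_one_pow_eq_zero {K : ℕ} {X Y : A} (h : JointlyNilpotent (K + 1) X Y) :
    (IsNilpotent.exp X * IsNilpotent.exp Y - 1) ^ (K + 1) = 0 := by
  rw [exp_mul_exp_sub_one_pow h]
  refine sum_eq_zero fun e he => ?_
  rw [prod_bchWord_eq_zero h, smul_zero]
  have : ∑ _i : Fin (K + 1), 1 ≤ ∑ i, ((e i).1 + (e i).2) := by
    refine sum_le_sum fun i _ => ?_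
    have := (mem_filter.1 (Fintype.mem_piFinset.1 he i)).2
    omega
  simpa using this

theorem nilLog_exp_mul_exp {K : ℕ} {X Y : A} (h : JointlyNilpotent (K + 1) X Y) :
    nilLog (IsNilpotent.exp X * IsNilpotent.exp Y - 1) =
      ∑ m ∈ range (K + 1), logTerm m X Y := by
  set F : ∀ l : ℕ, (Fin l → ℕ × ℕ) → A := fun l e =>
    ((-1 : ℚ) ^ (l + 1) / ((l : ℚ) *
      ∏ i, (((e i).1.factorial : ℚ) * ((e i).2.factorial : ℚ)))) • (bchWord X Y e).prod with hF
  have h1 : ∀ m ∈ range (K + 1), logTerm m X Y =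
      ∑ l ∈ range (K + 1), ∑ e ∈ bchExponents m l, F l e := by
    intro m hm
    rw [mem_range] at hm
    refine sum_subset (fun l hl => ?_) fun l _ hl => ?_
    · rw [mem_Icc] at hl
      rw [mem_range]
      omega
    · rw [mem_Icc, not_and_or] at hl
      rcases hl with hl | hl
      · obtain rfl : l = 0 := by omega
        simp
      · rw [bchExponents_eq_empty (by omega), sum_empty]
  rw [sum_congr rfl h1, sum_comm, nilLog_eq_sum (exp_mul_exp_sub_one_pow_eq_zero h)]
  refine sum_congr rfl fun l _ => ?_
  have h2 : ∀ m ∈ range (K + 1), ∑ e ∈ bchExponents m l, F l e =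
      ∑ e ∈ Fintype.piFinset (fun _ : Fin l => posPairs (K + 1)),
        if ∑ i, ((e i).1 + (e i).2) = m then F l e else 0 := by
    intro m hm
    rw [bchExponents_eq_filter (mem_range.1 hm), sum_filter]
  rw [sum_congr rfl h2, sum_comm, exp_mul_exp_sub_one_pow h, smul_sum]
  refine sum_congr rfl fun e _ => ?_
  rw [sum_ite_eq]
  split_ifs with hm
  · rw [hF, smul_smul]
    congr 1
    rw [div_mul_eq_div_div, div_eq_mul_inv _ (∏ i, _)]
  · rw [prod_bchWord_eq_zero h (not_lt.1 fun h' => hm (mem_range.2 h')), smul_zero, smul_zero]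

/-! ### The adjoint action of an associative algebra -/

variable (A) in
/-- `a ↦ [a, ·]`. -/
noncomputable def adj (a : A) : Module.End ℚ A := LinearMap.mulLeft ℚ a - LinearMap.mulRight ℚ a

theorem adj_apply (a b : A) : adj A a b = ⁅a, b⁆ := rfl

theorem adj_sum {ι : Type*} (s : Finset ι) (f : ι → A) :
    adj A (∑ i ∈ s, f i) = ∑ i ∈ s, adj A (f i) := by
  ext b
  simp [adj_apply, sum_lie]

theorem exp_mulLeft {a : A} (ha : IsNilpotent a) :
    IsNilpotent.exp (LinearMap.mulLeft ℚ a) = LinearMap.mulLeft ℚ (IsNilpotent.exp a) := by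
  obtain ⟨K, hK⟩ := ha
  rw [IsNilpotent.exp_eq_sum hK, IsNilpotent.exp_eq_sum (k := K)
    (by rw [LinearMap.pow_mulLeft, hK, LinearMap.mulLeft_zero_eq_zero])]
  ext b
  simp [LinearMap.pow_mulLeft, sum_mul]

theorem exp_mulRight {a : A} (ha : IsNilpotent a) :
    IsNilpotent.exp (LinearMap.mulRight ℚ a) = LinearMap.mulRight ℚ (IsNilpotent.exp a) := by
  obtain ⟨K, hK⟩ := ha
  rw [IsNilpotent.exp_eq_sum hK, IsNilpotent.exp_eq_sum (k := K)
    (by rw [LinearMap.pow_mulRight, hK, LinearMap.mulRight_zero_eq_zero])]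
  ext b
  simp [LinearMap.pow_mulRight, mul_sum]

theorem isNilpotent_mulLeft {a : A} (ha : IsNilpotent a) :
    IsNilpotent (LinearMap.mulLeft ℚ a) := by
  obtain ⟨K, hK⟩ := ha
  exact ⟨K, by rw [LinearMap.pow_mulLeft, hK, LinearMap.mulLeft_zero_eq_zero]⟩

theorem isNilpotent_mulRight {a : A} (ha : IsNilpotent a) :
    IsNilpotent (LinearMap.mulRight ℚ a) := by
  obtain ⟨K, hK⟩ := ha
  exact ⟨K, by rw [LinearMap.pow_mulRight, hK, LinearMap.mulRight_zero_eq_zero]⟩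

theorem isNilpotent_adj {a : A} (ha : IsNilpotent a) : IsNilpotent (adj A a) :=
  (LinearMap.commute_mulLeft_right a a).isNilpotent_sub (isNilpotent_mulLeft ha)
    (isNilpotent_mulRight ha)

/-- `exp (ad a)` is the conjugation by `exp a`. -/
theorem exp_adj_apply {a : A} (ha : IsNilpotent a) (b : A) :
    IsNilpotent.exp (adj A a) b = IsNilpotent.exp a * b * IsNilpotent.exp (-a) := by
  have hneg : -LinearMap.mulRight ℚ a = LinearMap.mulRight ℚ (-a) := by ext; simp
  rw [adj, sub_eq_add_neg, IsNilpotent.exp_add_of_commute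
    (LinearMap.commute_mulLeft_right (R := ℚ) a a).neg_right (isNilpotent_mulLeft ha)
    (isNilpotent_mulRight ha).neg, exp_mulLeft ha, hneg, exp_mulRight ha.neg]
  simp [mul_assoc]

/-- Both sides are the conjugation by `exp X * exp Y = exp Z`. -/
theorem exp_adj_mul_exp_adj {X Y Z : A} (hX : IsNilpotent X) (hY : IsNilpotent Y)
    (hZ : IsNilpotent Z) (h : IsNilpotent.exp Z = IsNilpotent.exp X * IsNilpotent.exp Y) :
    IsNilpotent.exp (adj A X) * IsNilpotent.exp (adj A Y) = IsNilpotent.exp (adj A Z) := by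
  have h1 : IsNilpotent.exp (-Z) = IsNilpotent.exp (-Y) * IsNilpotent.exp (-X) := by
    refine left_inv_eq_right_inv (IsNilpotent.exp_neg_mul_exp_self hZ) ?_
    rw [h, mul_assoc, ← mul_assoc (IsNilpotent.exp Y), IsNilpotent.exp_mul_exp_neg_self hY, one_mul,
      IsNilpotent.exp_mul_exp_neg_self hX]
  ext b
  rw [Module.End.mul_apply, exp_adj_apply hX, exp_adj_apply hY, exp_adj_apply hZ, h, h1]
  simp only [mul_assoc]

/-- A composition of `j` of the operators `ad X`, `ad Y` maps `s` to a combination of the products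
`u s v` with words `u`, `v` of total length `j`. -/
theorem JointlyNilpotent.adj {M : ℕ} {X Y : A} (h : JointlyNilpotent M X Y) :
    JointlyNilpotent (2 * M) (adj A X) (adj A Y) := by
  let F : ℕ → Submodule ℚ A := fun j => Submodule.span ℚ
    {t | ∃ (u v : List A) (s : A), (∀ a ∈ u, a = X ∨ a = Y) ∧ (∀ a ∈ v, a = X ∨ a = Y) ∧
      j ≤ u.length + v.length ∧ t = u.prod * s * v.prod}
  have hF0 : ∀ s, s ∈ F 0 := fun s => Submodule.subset_span ⟨[], [], s, by simp⟩
  have hFM : ∀ j, 2 * M ≤ j → ∀ t ∈ F j, t = 0 := by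
    intro j hj t ht
    have : F j ≤ ⊥ := by
      refine Submodule.span_le.2 ?_
      rintro t ⟨u, v, s, hu, hv, hl, rfl⟩
      have : M ≤ u.length ∨ M ≤ v.length := by omega
      rcases this with h1 | h1
      · simp [h u hu h1]
      · simp [h v hv h1]
    exact (Submodule.mem_bot ℚ).1 (this ht)
  have hFS : ∀ a, (a = X ∨ a = Y) → ∀ j, ∀ t ∈ F j, a * t - t * a ∈ F (j + 1) := by
    intro a ha j t ht
    refine sub_mem ?_ ?_
    · have : F j ≤ (F (j + 1)).comap (LinearMap.mulLeft ℚ a) := by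
        refine Submodule.span_le.2 ?_
        rintro t ⟨u, v, s, hu, hv, hl, rfl⟩
        refine Submodule.subset_span ⟨a :: u, v, s, ?_, hv, ?_, ?_⟩
        · simpa [ha] using hu
        · simp only [List.length_cons]; omega
        · simp [mul_assoc]
      exact this ht
    · have : F j ≤ (F (j + 1)).comap (LinearMap.mulRight ℚ a) := by
        refine Submodule.span_le.2 ?_
        rintro t ⟨u, v, s, hu, hv, hl, rfl⟩
        refine Submodule.subset_span ⟨u, v ++ [a], s, hu, ?_, ?_, ?_⟩
        · intro c hc
          rw [List.mem_append, List.mem_singleton] at hc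
          rcases hc with hc | rfl
          · exact hv c hc
          · exact ha
        · simp only [List.length_append, List.length_singleton]; omega
        · simp [mul_assoc]
      exact this ht
  intro w hw hl
  ext s
  refine hFM _ hl _ ?_
  clear hl
  induction w with
  | nil => exact hF0 s
  | cons c w ih =>
    rw [List.prod_cons, Module.End.mul_apply, List.length_cons]
    have h1 := ih fun a ha => hw a (List.mem_cons_of_mem _ ha)
    rcases hw c List.mem_cons_self with rfl | rfl
    · exact hFS X (Or.inl rfl) _ _ h1
    · exact hFS Y (Or.inr rfl) _ _ h1

/-- If `[a, H] = a` for all the letters `a` of a word, then the corresponding composition of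
adjoint operators maps `H` to the nested bracket of the word. -/
theorem prod_adj_apply {H : A} {w : List A} (hw : ∀ a ∈ w, ⁅a, H⁆ = a) (hne : w ≠ []) :
    (w.map (adj A)).prod H = nestedBracket w := by
  induction w with
  | nil => exact absurd rfl hne
  | cons a w ih =>
    cases w with
    | nil => simpa [nestedBracket, adj_apply] using hw a
    | cons b w =>
      rw [List.map_cons, List.prod_cons, Module.End.mul_apply,
        ih (fun c hc => hw c (List.mem_cons_of_mem _ hc)) (by simp)]
      rfl

theorem logTerm_adj_apply {X Y H : A} (hX : ⁅X, H⁆ = X) (hY : ⁅Y, H⁆ = Y) (m : ℕ) :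
    logTerm m (adj A X) (adj A Y) H = (m : ℚ) • bchTerm ℚ m X Y := by
  rw [logTerm, bchTerm, smul_sum, LinearMap.sum_apply]
  refine sum_congr rfl fun l hl => ?_
  rw [smul_sum, LinearMap.sum_apply]
  refine sum_congr rfl fun e he => ?_
  rw [mem_Icc] at hl
  have hm : (m : ℚ) ≠ 0 := by
    have : m ≠ 0 := by omega
    exact_mod_cast this
  rw [LinearMap.smul_apply, ← map_bchWord (adj A) X Y e, prod_adj_apply, smul_smul]
  · congr 1
    have h1 : (l : ℚ) ≠ 0 := by
      have : l ≠ 0 := by omega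
      exact_mod_cast this
    field_simp
  · intro a ha
    rcases mem_bchWord ha with rfl | rfl
    · exact hX
    · exact hY
  · intro h
    have := length_bchWord X Y he
    rw [h, List.length_nil] at this
    omega

/-! ### Grading an algebra by a shift -/

/-- Left multiplication by `a`, followed by a shift by `j`, on the sequences in `A`. This puts `a`
into degree `j`. -/
noncomputable def shiftMul (j : ℕ) (a : A) : Module.End ℚ (ℕ → A) where
  toFun f i := a * f (i + j)
  map_add' f g := by ext i; simp [mul_add]
  map_smul' c f := by ext i; simp

theorem shiftMul_apply (j : ℕ) (a : A) (f : ℕ → A) (i : ℕ) :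
    shiftMul j a f i = a * f (i + j) := rfl

theorem shiftMul_mul (i j : ℕ) (a b : A) :
    shiftMul i a * shiftMul j b = shiftMul (i + j) (a * b) := by
  ext f n
  simp [shiftMul_apply, mul_assoc, add_assoc]

theorem shiftMul_sub (j : ℕ) (a b : A) : shiftMul j (a - b) = shiftMul j a - shiftMul j b := by
  ext f n
  simp [shiftMul_apply, sub_mul]

theorem shiftMul_smul (j : ℕ) (c : ℚ) (a : A) : shiftMul j (c • a) = c • shiftMul j a := by
  ext f n
  simp [shiftMul_apply]

theorem shiftMul_sum {ι : Type*} (j : ℕ) (s : Finset ι) (g : ι → A) :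
    shiftMul j (∑ x ∈ s, g x) = ∑ x ∈ s, shiftMul j (g x) := by
  ext f n
  simp [shiftMul_apply, sum_mul]

theorem prod_map_shiftMul (w : List A) :
    (w.map (shiftMul 1)).prod = shiftMul w.length w.prod := by
  induction w with
  | nil => ext f n; simp [shiftMul_apply]
  | cons a w ih => rw [List.map_cons, List.prod_cons, ih, shiftMul_mul, List.prod_cons,
      List.length_cons, add_comm]

theorem nestedBracket_map_shiftMul (w : List A) :
    nestedBracket (w.map (shiftMul 1)) = shiftMul w.length (nestedBracket w) := by
  induction w with
  | nil => ext f n; simp [shiftMul_apply, nestedBracket]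
  | cons a w ih =>
    cases w with
    | nil => rfl
    | cons b w =>
      rw [List.map_cons] at ih
      simp only [List.map_cons, nestedBracket, ih, Ring.lie_def, shiftMul_mul, shiftMul_sub,
        List.length_cons]
      rw [add_comm 1]

theorem logTerm_shiftMul (m : ℕ) (X Y : A) :
    logTerm m (shiftMul 1 X) (shiftMul 1 Y) = shiftMul m (logTerm m X Y) := by
  simp only [logTerm, shiftMul_sum, shiftMul_smul]
  refine sum_congr rfl fun l _ => sum_congr rfl fun e he => ?_
  rw [← map_bchWord, prod_map_shiftMul, length_bchWord _ _ he]

theorem bchTerm_shiftMul (m : ℕ) (X Y : A) :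
    bchTerm ℚ m (shiftMul 1 X) (shiftMul 1 Y) = shiftMul m (bchTerm ℚ m X Y) := by
  simp only [bchTerm, shiftMul_sum, shiftMul_smul]
  refine sum_congr rfl fun l _ => sum_congr rfl fun e he => ?_
  rw [← map_bchWord, nestedBracket_map_shiftMul, length_bchWord _ _ he]

variable (A) in
/-- The operator multiplying the `i`-th term of a sequence by `i`. -/
noncomputable def indexMul : Module.End ℚ (ℕ → A) where
  toFun f i := (i : ℚ) • f i
  map_add' f g := by ext i; simp
  map_smul' c f := by ext i; simp [smul_comm c]

theorem lie_shiftMul_indexMul (j : ℕ) (a : A) :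
    ⁅shiftMul j a, indexMul A⁆ = (j : ℚ) • shiftMul j a := by
  ext f i
  simp only [Ring.lie_def, LinearMap.sub_apply, Module.End.mul_apply, LinearMap.smul_apply,
    Pi.sub_apply, Pi.smul_apply, shiftMul_apply]
  simp only [indexMul, LinearMap.coe_mk, AddHom.coe_mk, shiftMul_apply]
  rw [mul_smul_comm, ← sub_smul]
  congr 1
  push_cast
  ring

theorem JointlyNilpotent.shiftMul {M : ℕ} {X Y : A} (h : JointlyNilpotent M X Y) :
    JointlyNilpotent M (shiftMul 1 X) (shiftMul 1 Y) := by
  intro w hw hl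
  obtain ⟨v, hv, rfl⟩ : ∃ v : List A, (∀ a ∈ v, a = X ∨ a = Y) ∧ v.map (_root_.shiftMul 1) = w := by
    clear hl
    induction w with
    | nil => exact ⟨[], by simp⟩
    | cons c w ih =>
      obtain ⟨v, hv, rfl⟩ := ih fun a ha => hw a (List.mem_cons_of_mem _ ha)
      rcases hw c List.mem_cons_self with rfl | rfl
      · exact ⟨X :: v, by simpa using hv, rfl⟩
      · exact ⟨Y :: v, by simpa using hv, rfl⟩
  rw [List.length_map] at hl
  rw [prod_map_shiftMul, h v hv hl]
  ext f i
  simp [shiftMul_apply]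

/-- Dynkin's formula: `(1/m) D`, where `D` replaces a word by its nested bracket, fixes the part of
degree `m` of `log (e^X e^Y)`. -/
theorem logTerm_eq_bchTerm {M : ℕ} {X Y : A} (h : JointlyNilpotent M X Y) (m : ℕ) :
    logTerm m X Y = bchTerm ℚ m X Y := by
  rcases Nat.eq_zero_or_pos m with rfl | hm0
  · simp [logTerm, bchTerm]
  -- `2 M` is what the nilpotency of `ad x` and `ad y` requires; the part of degree `m` has to be
  -- among the terms of the sum.
  set K := 2 * M + m with hK
  set x := shiftMul 1 X with hx
  set y := shiftMul 1 Y with hy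
  have hn : JointlyNilpotent (K + 1) x y := h.shiftMul.mono (by omega)
  have hxH : ⁅x, indexMul A⁆ = x := by simpa using lie_shiftMul_indexMul 1 X
  have hyH : ⁅y, indexMul A⁆ = y := by simpa using lie_shiftMul_indexMul 1 Y
  have hW : IsNilpotent (IsNilpotent.exp x * IsNilpotent.exp y - 1) :=
    ⟨_, exp_mul_exp_sub_one_pow_eq_zero hn⟩
  have hZn := isNilpotent_nilLog hW
  have hZ := exp_nilLog hW
  rw [add_sub_cancel] at hZ
  have h1 := exp_adj_mul_exp_adj ⟨_, hn.pow_left⟩ ⟨_, hn.pow_right⟩ hZn hZ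
  -- `log (e^{ad x} e^{ad y}) = ad (log (e^x e^y))`, to be applied to `H = indexMul A`.
  have h2 : ∑ m ∈ range (K + 1), logTerm m (adj _ x) (adj _ y) =
      adj _ (∑ m ∈ range (K + 1), logTerm m x y) := by
    rw [← nilLog_exp_mul_exp hn, ← nilLog_exp_mul_exp (h.shiftMul.adj.mono (by omega)), h1,
      nilLog_exp_sub_one (isNilpotent_adj hZn)]
  have h3 := congrArg (fun T => T (indexMul A)) h2
  simp only [adj_sum, LinearMap.sum_apply, logTerm_adj_apply hxH hyH] at h3
  simp only [hx, hy, adj_apply, bchTerm_shiftMul, logTerm_shiftMul, lie_shiftMul_indexMul] at h3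
  -- Evaluation at `0` on the sequence concentrated at `m` extracts the part of degree `m`.
  have h4 := congrFun (congrArg (fun T => T (Pi.single m 1)) h3) 0
  simp only [LinearMap.sum_apply, Finset.sum_apply, LinearMap.smul_apply, Pi.smul_apply,
    shiftMul_apply, zero_add] at h4
  have h5 : ∀ T : ℕ → A, ∑ i ∈ range (K + 1), (i : ℚ) • (T i * (Pi.single m 1 : ℕ → A) i) =
      (m : ℚ) • T m := by
    intro T
    rw [sum_eq_single m]
    · simp
    · intro i _ hi
      simp [hi]
    · intro hi
      exact absurd (mem_range.2 (by omega)) hi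
  rw [h5, h5] at h4
  have hm : (m : ℚ) ≠ 0 := by
    have : m ≠ 0 := by omega
    exact_mod_cast this
  exact (smul_right_injective A hm h4).symm

/-- The Baker-Campbell-Hausdorff formula in an associative algebra. -/
theorem exp_sum_bchTerm {K : ℕ} {X Y : A} (h : JointlyNilpotent (K + 1) X Y) :
    IsNilpotent.exp (∑ m ∈ range (K + 1), bchTerm ℚ m X Y) =
      IsNilpotent.exp X * IsNilpotent.exp Y := by
  simp only [← logTerm_eq_bchTerm h]
  rw [← nilLog_exp_mul_exp h, exp_nilLog ⟨_, exp_mul_exp_sub_one_pow_eq_zero h⟩, add_sub_cancel]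

end

theorem bchTerm_eq_bchTerm_rat {k 𝔤 : Type*} [Field k] [CharZero k] [LieRing 𝔤] [LieAlgebra k 𝔤]
    [LieAlgebra ℚ 𝔤] (m : ℕ) (X Y : 𝔤) : bchTerm k m X Y = bchTerm ℚ m X Y := by
  refine sum_congr rfl fun l _ => sum_congr rfl fun e _ => ?_
  rw [← Rat.cast_smul_eq_qsmul k]
  congr 1
  push_cast
  rfl

end DynkinFormula

/-! ### A faithful representation of the structure group -/

section Representation

variable {N : Type*} [AddCommGroup N]

/-- The monoid `N⁺ ∪ {0}`. -/
def NNonneg (b : Module.Basis (Fin 2) ℤ N) : AddSubmonoid N where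
  carrier := {n | 0 ≤ b.repr n 0 ∧ 0 ≤ b.repr n 1}
  zero_mem' := by simp
  add_mem' := by
    rintro x y ⟨h1, h2⟩ ⟨h3, h4⟩
    simp only [Set.mem_ofPred_eq, map_add, Finsupp.add_apply]
    exact ⟨by omega, by omega⟩

variable {b : Module.Basis (Fin 2) ℤ N}

/-- The inclusion of `N⁺` in `N⁺ ∪ {0}`. -/
def NPlus.toNonneg (n : NPlus b) : NNonneg b := ⟨n, n.2.1, n.2.2.1⟩

theorem NPlus.toNonneg_add (n m : NPlus b) :
    NPlus.toNonneg (n + m) = NPlus.toNonneg n + NPlus.toNonneg m := rfl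

theorem NPlus.toNonneg_mul (j : ℕ+) (n : NPlus b) :
    NPlus.toNonneg (NPlus.mul j n) = (j : ℕ) • NPlus.toNonneg n := rfl

theorem NPlus.toNonneg_injective : Function.Injective (NPlus.toNonneg (b := b)) :=
  fun _ _ h => Subtype.ext (congrArg (fun x : NNonneg b => (x : N)) h)

/-- The degree on `N⁺ ∪ {0}`. -/
noncomputable def NNonneg.deg (m : NNonneg b) : ℤ := b.repr (m : N) 0 + b.repr (m : N) 1

theorem NNonneg.deg_add (m m' : NNonneg b) :
    NNonneg.deg (m + m') = NNonneg.deg m + NNonneg.deg m' := by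
  simp only [NNonneg.deg, AddSubmonoid.coe_add, map_add, Finsupp.add_apply]
  ring

theorem NNonneg.deg_nonneg (m : NNonneg b) : 0 ≤ NNonneg.deg m := add_nonneg m.2.1 m.2.2

theorem NNonneg.deg_toNonneg (n : NPlus b) : NNonneg.deg (NPlus.toNonneg n) = NPlus.deg n := rfl

theorem NNonneg.deg_nsmul (i : ℕ) (m : NNonneg b) :
    NNonneg.deg (i • m) = i * NNonneg.deg m := by
  induction i with
  | zero => simp [NNonneg.deg]
  | succ i ih => rw [succ_nsmul, NNonneg.deg_add, ih]; push_cast; ring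

variable (k : Type*) [Field k] (ω : SkewForm N) (L : CofiniteIdeal b)

/-- The functions on `N⁺ ∪ {0}` that vanish on `L`, as a subspace of all functions. -/
def funSubmodule : Submodule k (NNonneg b → k) where
  carrier := {f | ∀ l ∈ L.carrier, f (NPlus.toNonneg l) = 0}
  add_mem' hf hg l hl := by simp [hf l hl, hg l hl]
  zero_mem' l _ := rfl
  smul_mem' a f hf l hl := by simp [hf l hl]

/-- The vector space of the functions on `N⁺ ∪ {0}` that vanish on `L`. -/
def FunMod : Type _ := funSubmodule k L

noncomputable instance : AddCommGroup (FunMod k L) :=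
  inferInstanceAs (AddCommGroup (funSubmodule k L))

noncomputable instance : Module k (FunMod k L) := inferInstanceAs (Module k (funSubmodule k L))

noncomputable instance [CharZero k] : Module ℚ (FunMod k L) :=
  Module.compHom _ (algebraMap ℚ k)

instance [CharZero k] : IsScalarTower ℚ k (FunMod k L) where
  smul_assoc q a f := by
    rw [Algebra.smul_def, mul_smul]
    rfl

/-- All functions of `FunMod k L` vanish in the degrees `≥ K`. -/
def VanishesFrom (K : ℕ) : Prop :=
  ∀ (f : FunMod k L) (m : NNonneg b), (K : ℤ) ≤ NNonneg.deg m → f.1 m = 0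

theorem exists_vanishesFrom : ∃ K, VanishesFrom k L K := by
  obtain ⟨M, hM⟩ := L.exists_deg
  -- The point `0` does not lie in `N⁺`, so that the bound `M = 0` would not do for it.
  refine ⟨M + 1, fun f m hm => ?_⟩
  have h : 0 < NNonneg.deg m := by push_cast at hm; omega
  exact f.2 ⟨m, m.2.1, m.2.2, h⟩ (hM _ (by push_cast at hm; change _ ≤ NNonneg.deg m; omega))

namespace FunMod

variable {k L}

theorem ext {f g : FunMod k L} (h : ∀ m, f.1 m = g.1 m) : f = g := Subtype.ext (funext h)

/-- The operator `f ↦ f (· + n)`. -/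
def shift (n : NPlus b) : Module.End k (FunMod k L) where
  toFun f := ⟨fun m => f.1 (m + NPlus.toNonneg n), fun l hl => by
    change f.1 (NPlus.toNonneg l + NPlus.toNonneg n) = 0
    rw [add_comm, ← NPlus.toNonneg_add]
    exact f.2 _ (L.add_mem n l hl)⟩
  map_add' f g := rfl
  map_smul' a f := rfl

theorem shift_apply (n : NPlus b) (f : FunMod k L) (m : NNonneg b) :
    (shift n f).1 m = f.1 (m + NPlus.toNonneg n) := rfl

theorem shift_pow_apply (n : NPlus b) (i : ℕ) (f : FunMod k L) (m : NNonneg b) :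
    ((shift n ^ i) f).1 m = f.1 (m + i • NPlus.toNonneg n) := by
  induction i generalizing m with
  | zero => simp
  | succ i ih =>
    rw [pow_succ', Module.End.mul_apply, shift_apply, ih, succ_nsmul, add_assoc,
      add_comm (NPlus.toNonneg n)]

/-- The coefficient `{m, n} + deg n` of the action of `X_n` at `m`. -/
noncomputable def weight (m : NNonneg b) (n : NPlus b) : ℚ := ω.form (m : N) (n : N) + NPlus.deg n

/-- The operator by which `X_n` acts: `f ↦ ({·, n} + deg n) f (· + n)`. The summand `deg n` makes
the action on `FunMod k L` faithful even if the form is degenerate. -/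
noncomputable def genOp (n : NPlus b) : Module.End k (FunMod k L) where
  toFun f := ⟨fun m => (weight ω m n : k) * (shift n f).1 m, fun l hl => by
    change _ * _ = (0 : k)
    rw [(shift n f).2 l hl, mul_zero]⟩
  map_add' f g := ext fun m => by
    change _ * (shift n (f + g)).1 m = _ * (shift n f).1 m + _ * (shift n g).1 m
    rw [map_add]
    exact mul_add _ _ _
  map_smul' a f := ext fun m => by
    change _ * (shift n (a • f)).1 m = a * (_ * (shift n f).1 m)
    rw [map_smul]
    exact mul_left_comm _ _ _

theorem genOp_apply (n : NPlus b) (f : FunMod k L) (m : NNonneg b) :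
    (genOp ω n f).1 m = (weight ω m n : k) * f.1 (m + NPlus.toNonneg n) := rfl

theorem genOp_lie [CharZero k] (n n' : NPlus b) :
    (genOp ω n * genOp ω n' - genOp ω n' * genOp ω n : Module.End k (FunMod k L)) =
      ((ω.form (n : N) (n' : N) : ℚ) : k) • genOp ω (n + n') := by
  refine LinearMap.ext fun f => FunMod.ext (k := k) (L := L) fun m => ?_
  change (genOp ω n (genOp ω n' f)).1 m - (genOp ω n' (genOp ω n f)).1 m =
    _ * (genOp ω (n + n') f).1 m
  simp only [genOp_apply, NPlus.toNonneg_add, add_assoc]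
  rw [add_comm (NPlus.toNonneg n') (NPlus.toNonneg n)]
  have h : weight ω m n * weight ω (m + NPlus.toNonneg n) n' -
      weight ω m n' * weight ω (m + NPlus.toNonneg n') n =
      ω.form (n : N) (n' : N) * weight ω m (n + n') := by
    have h2 := ω.skew (n' : N) (n : N)
    simp only [weight, AddMemClass.coe_add, map_add, LinearMap.add_apply,
      NPlus.deg_add, NPlus.toNonneg]
    push_cast
    rw [h2]
    ring
  have h' := congrArg (fun q : ℚ => (q : k)) h
  push_cast at h'
  linear_combination f.1 (m + (NPlus.toNonneg n + NPlus.toNonneg n')) * h'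

end FunMod

open FunMod

variable [CharZero k]

theorem lift_genOp_lie (x y : TorusLie k b ω) :
    TorusLie.lift (V := Module.End k (FunMod k L)) (genOp ω) ⁅x, y⁆ =
      TorusLie.lift (genOp ω) x * TorusLie.lift (genOp ω) y -
        TorusLie.lift (genOp ω) y * TorusLie.lift (genOp ω) x := by
  induction x using TorusLie.induction_X with
  | h0 => simp
  | hadd x x' hx hx' => rw [add_lie, map_add, map_add, hx, hx', add_mul, mul_add]; abel
  | hX r n =>
    induction y using TorusLie.induction_X with
    | h0 => simp
    | hadd y y' hy hy' => rw [lie_add, map_add, map_add, hy, hy', add_mul, mul_add]; abel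
    | hX s n' =>
      rw [smul_lie, lie_smul, TorusLie.lie_def, TorusLie.bracketHom_X]
      simp only [map_smul, TorusLie.lift_X]
      rw [smul_mul_smul_comm, smul_mul_smul_comm, mul_comm s r, ← smul_sub, genOp_lie,
        smul_smul]

attribute [local instance] LieRing.ofAssociativeRing

/-- The action of `𝔤` on `FunMod k L`. -/
noncomputable def torusRep : TorusLie k b ω →ₗ⁅k⁆ Module.End k (FunMod k L) :=
  { TorusLie.lift (k := k) (b := b) (ω := ω) (V := Module.End k (FunMod k L)) (genOp ω) with
    map_lie' := fun {x y} => lift_genOp_lie k ω L x y }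

variable {k ω L}

theorem torusRep_X (n : NPlus b) : torusRep k ω L (TorusLie.X k ω n) = genOp ω n :=
  TorusLie.lift_X _ n

omit [CharZero k] in
/-- `L` acts trivially, since `N⁺ ∪ {0}` shifted by an element of `L` is contained in `L`. -/
theorem genOp_eq_zero {n : NPlus b} (hn : n ∈ L.carrier) :
    (genOp ω n : Module.End k (FunMod k L)) = 0 := by
  refine LinearMap.ext fun f => FunMod.ext fun m => ?_
  have h : m + NPlus.toNonneg n ∈ NPlus.toNonneg '' L.carrier := by
    by_cases hm : NNonneg.deg m = 0
    · refine ⟨n, hn, ?_⟩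
      have : m = 0 := by
        have h1 := m.2.1
        have h2 := m.2.2
        have h3 : b.repr (m : N) 0 + b.repr (m : N) 1 = 0 := hm
        refine Subtype.ext (b.repr.injective (Finsupp.ext fun i => ?_))
        fin_cases i
        · simp; omega
        · simp; omega
      rw [this, zero_add]
    · have h0 := NNonneg.deg_nonneg m
      exact ⟨⟨m, m.2.1, m.2.2, lt_of_le_of_ne h0 (Ne.symm hm)⟩ + n, L.add_mem _ _ hn, rfl⟩
  obtain ⟨l, hl, h⟩ := h
  rw [genOp_apply, ← h, f.2 l hl, mul_zero]
  rfl

theorem torusRep_eq_zero {x : TorusLie k b ω} (hx : x ∈ TorusLie.supported k b ω L.carrier) :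
    torusRep k ω L x = 0 := by
  refine TorusLie.supported_induction (p := fun x => torusRep k ω L x = 0) hx (map_zero _)
    (fun x y hx hy => by rw [map_add, hx, hy, add_zero]) fun a n hn => ?_
  rw [map_smul, torusRep_X, genOp_eq_zero hn, smul_zero]

variable (k ω L) in
/-- The action of `𝔤_L` on `FunMod k L`. -/
noncomputable def torusModRep : TorusLieMod k ω L →ₗ⁅k⁆ Module.End k (FunMod k L) :=
  { (TorusLie.ideal k ω L).toSubmodule.liftQ
      (torusRep k ω L : TorusLie k b ω →ₗ[k] Module.End k (FunMod k L))
      (fun _ hx => torusRep_eq_zero hx) with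
    map_lie' := by
      intro x y
      obtain ⟨x, rfl⟩ := TorusLieMod.mk_surjective L x
      obtain ⟨y, rfl⟩ := TorusLieMod.mk_surjective L y
      rw [← LieHom.map_lie]
      exact LieHom.map_lie (torusRep k ω L) x y }

theorem torusModRep_mk (x : TorusLie k b ω) :
    torusModRep k ω L (TorusLieMod.mk k ω L x) = torusRep k ω L x := rfl

/-- The coefficient of `X_n` in `x`, times `deg n`, is the value at `0` of `x` applied to the
characteristic function of `n`. -/
theorem torusModRep_injective : Function.Injective (torusModRep k ω L) := by
  classical
  refine (injective_iff_map_eq_zero _).2 fun x hx => ?_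
  obtain ⟨x, rfl⟩ := TorusLieMod.mk_surjective L x
  rw [torusModRep_mk] at hx
  refine TorusLieMod.mk_eq_zero.2 fun n hn => ?_
  let δ : FunMod k L := ⟨Pi.single (NPlus.toNonneg n) 1, fun l hl => by
    rw [Pi.single_eq_of_ne]
    intro h
    exact hn (NPlus.toNonneg_injective h ▸ hl)⟩
  have h : ∀ y : TorusLie k b ω,
      (torusRep k ω L y δ).1 0 = (NPlus.deg n : k) * TorusLie.coeff n y := by
    intro y
    induction y using TorusLie.induction_X with
    | h0 =>
      rw [map_zero, map_zero, mul_zero]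
      rfl
    | hadd y y' h h' =>
      rw [map_add, map_add, mul_add, ← h, ← h']
      rfl
    | hX a n' =>
      rw [map_smul, torusRep_X, map_smul, TorusLie.coeff_X]
      change a * (genOp ω n' δ).1 0 = _
      rw [genOp_apply, zero_add]
      by_cases hn' : n' = n
      · subst hn'
        simp [δ, weight]
        ring
      · have : NPlus.toNonneg n' ≠ NPlus.toNonneg n := fun h => hn' (NPlus.toNonneg_injective h)
        simp [δ, hn', this]
  have h1 := h x
  rw [hx] at h1
  have h2 : (NPlus.deg n : k) ≠ 0 := by
    have := NPlus.deg_pos n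
    exact_mod_cast this.ne'
  exact (mul_eq_zero.1 h1.symm).resolve_left h2

theorem torusModRep_apply_eq_zero {d : ℤ} {f : FunMod k L}
    (hf : ∀ m : NNonneg b, d + 1 ≤ NNonneg.deg m → f.1 m = 0) (x : TorusLieMod k ω L)
    {m : NNonneg b} (hm : d ≤ NNonneg.deg m) : (torusModRep k ω L x f).1 m = 0 := by
  obtain ⟨x, rfl⟩ := TorusLieMod.mk_surjective L x
  rw [torusModRep_mk]
  induction x using TorusLie.induction_X with
  | h0 => rw [map_zero]; rfl
  | hadd x y hx hy =>
    rw [map_add]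
    change (torusRep k ω L x f).1 m + (torusRep k ω L y f).1 m = 0
    rw [hx, hy, add_zero]
  | hX a n =>
    rw [map_smul, torusRep_X]
    change a * (genOp ω n f).1 m = 0
    rw [genOp_apply, hf, mul_zero, mul_zero]
    rw [NNonneg.deg_add, NNonneg.deg_toNonneg]
    have := NPlus.deg_pos n
    omega

/-- Elements of `𝔤` strictly increase the degree at which a function is evaluated. -/
theorem exists_jointlyNilpotent_torusModRep (k : Type*) [Field k] [CharZero k] (ω : SkewForm N)
    (L : CofiniteIdeal b) : ∃ M : ℕ, ∀ x y : TorusLieMod k ω L,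
      JointlyNilpotent M (torusModRep k ω L x) (torusModRep k ω L y) := by
  obtain ⟨M, hM⟩ := exists_vanishesFrom k L
  refine ⟨M, fun x y w hw hl => LinearMap.ext fun f => FunMod.ext fun m => ?_⟩
  suffices h : ∀ m : NNonneg b, (M : ℤ) ≤ NNonneg.deg m + w.length → (w.prod f).1 m = 0 by
    refine h m ?_
    have := NNonneg.deg_nonneg m
    omega
  clear hl m
  induction w with
  | nil =>
    intro m hm
    exact hM f m (by simpa using hm)
  | cons a w ih =>
    intro m hm
    have h1 := ih fun c hc => hw c (List.mem_cons_of_mem _ hc)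
    have h2 : ∀ m : NNonneg b, (M - w.length - 1 : ℤ) + 1 ≤ NNonneg.deg m → (w.prod f).1 m = 0 :=
      fun m hm => h1 m (by omega)
    rw [List.length_cons] at hm
    push_cast at hm
    rw [List.prod_cons, Module.End.mul_apply]
    rcases hw a List.mem_cons_self with rfl | rfl
    · exact torusModRep_apply_eq_zero h2 x (by omega)
    · exact torusModRep_apply_eq_zero h2 y (by omega)

theorem isNilpotent_torusModRep (x : TorusLieMod k ω L) : IsNilpotent (torusModRep k ω L x) := by
  obtain ⟨M, hM⟩ := exists_jointlyNilpotent_torusModRep k ω L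
  exact ⟨M, (hM x x).pow_left⟩

namespace StructureGroupMod

/-- The action of `G_L` on `FunMod k L`. -/
noncomputable def rep (g : StructureGroupMod k ω L) : Module.End k (FunMod k L) :=
  IsNilpotent.exp (torusModRep k ω L g.log)

theorem rep_injective : Function.Injective (rep (k := k) (ω := ω) (L := L)) := fun _ _ h =>
  StructureGroupMod.ext (torusModRep_injective (exp_injective_of_isNilpotent
    (isNilpotent_torusModRep _) (isNilpotent_torusModRep _) h))

theorem rep_one : rep (1 : StructureGroupMod k ω L) = 1 := by
  change IsNilpotent.exp (torusModRep k ω L 0) = 1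
  rw [map_zero, IsNilpotent.exp_zero]

theorem rep_mul (g h : StructureGroupMod k ω L) : rep (g * h) = rep g * rep h := by
  obtain ⟨M, hM⟩ := exists_jointlyNilpotent_torusModRep k ω L
  obtain ⟨M', hM'⟩ := (TorusLieMod.finite_support_bchTerm g.log h.log).bddAbove
  change IsNilpotent.exp (torusModRep k ω L (bch k g.log h.log)) = _
  rw [bch, finsum_eq_sum_of_support_subset (s := Finset.range (M + M' + 1)) _ (fun m hm => by
    have := hM' hm
    simp only [Finset.coe_range, Set.mem_Iio]
    omega), map_sum]
  simp only [map_bchTerm, bchTerm_eq_bchTerm_rat]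
  exact exp_sum_bchTerm ((hM g.log h.log).mono (by omega))

end StructureGroupMod

end Representation

/-! ### An identity between binomial coefficients -/

section BinomialIdentity

open Finset

theorem choose_eq_eval_descPochhammer (x : ℚ) (j : ℕ) :
    Ring.choose x j = (j.factorial : ℚ)⁻¹ * (descPochhammer ℚ j).eval x := by
  induction j with
  | zero => simp
  | succ j ih =>
    have h1 : ((j : ℚ) + 1) ≠ 0 := by positivity
    refine mul_left_cancel₀ h1 ?_
    have h2 : (j.factorial : ℚ) ≠ 0 := by positivity
    rw [succ_mul_choose_succ, ih, descPochhammer_succ_eval, Nat.factorial_succ]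
    push_cast
    field_simp

/-- A function `ℚ → ℚ` given by a polynomial. -/
def IsPolyFun (f : ℚ → ℚ) : Prop := ∃ p : Polynomial ℚ, ∀ x, f x = p.eval x

theorem IsPolyFun.const (r : ℚ) : IsPolyFun fun _ => r := ⟨Polynomial.C r, fun x => by simp⟩

theorem IsPolyFun.mul {f g : ℚ → ℚ} (hf : IsPolyFun f) (hg : IsPolyFun g) :
    IsPolyFun fun x => f x * g x := by
  obtain ⟨p, hp⟩ := hf
  obtain ⟨q, hq⟩ := hg
  exact ⟨p * q, fun x => by simp [hp, hq]⟩

theorem IsPolyFun.sum {ι : Type*} (s : Finset ι) {f : ι → ℚ → ℚ}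
    (hf : ∀ i ∈ s, IsPolyFun (f i)) : IsPolyFun fun x => ∑ i ∈ s, f i x := by
  choose! p hp using hf
  refine ⟨∑ i ∈ s, p i, fun x => ?_⟩
  rw [Polynomial.eval_finsetSum]
  exact sum_congr rfl fun i hi => hp i hi x

theorem IsPolyFun.choose_add (r : ℚ) (j : ℕ) : IsPolyFun fun x => Ring.choose (x + r) j :=
  ⟨(Polynomial.C ((j.factorial : ℚ)⁻¹) * descPochhammer ℚ j).comp (Polynomial.X + Polynomial.C r),
    fun x => by simp [choose_eq_eval_descPochhammer, Polynomial.eval_comp]⟩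

/-- Polynomial functions that agree on `ℕ` are equal. -/
theorem IsPolyFun.eq_of_nat {f g : ℚ → ℚ} (hf : IsPolyFun f) (hg : IsPolyFun g)
    (h : ∀ n : ℕ, f n = g n) (x : ℚ) : f x = g x := by
  obtain ⟨p, hp⟩ := hf
  obtain ⟨q, hq⟩ := hg
  have : p = q := by
    refine Polynomial.eq_of_infinite_eval_eq p q
      ((Set.infinite_range_of_injective (Nat.cast_injective (R := ℚ))).mono ?_)
    rintro _ ⟨n, rfl⟩
    exact (hp n).symm.trans ((h n).trans (hq n))
  rw [hp, hq, this]

/-- The binomial coefficient of `x` over `b - l`, which is `0` if `b < l`. -/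
noncomputable def chooseSub (x : ℚ) (b l : ℕ) : ℚ := if l ≤ b then Ring.choose x (b - l) else 0

theorem chooseSub_zero_right (x : ℚ) (b : ℕ) : chooseSub x b 0 = Ring.choose x b := by
  simp [chooseSub]

theorem chooseSub_succ_succ (x : ℚ) (b l : ℕ) :
    chooseSub x (b + 1) (l + 1) = chooseSub x b l := by
  simp [chooseSub]

theorem chooseSub_of_lt (x : ℚ) {b l : ℕ} (h : b < l) : chooseSub x b l = 0 :=
  if_neg (not_le.2 h)

theorem chooseSub_add_one (x : ℚ) (b l : ℕ) :
    chooseSub (x + 1) b l = chooseSub x b l + chooseSub x b (l + 1) := by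
  rcases lt_trichotomy l b with h | rfl | h
  · obtain ⟨d, rfl⟩ := Nat.exists_eq_add_of_lt h
    rw [chooseSub, chooseSub, chooseSub, if_pos (by omega), if_pos (by omega), if_pos (by omega),
      show l + d + 1 - l = d + 1 by omega, show l + d + 1 - (l + 1) = d by omega,
      Ring.choose_succ_succ, add_comm]
  · simp [chooseSub]
  · rw [chooseSub_of_lt _ h, chooseSub_of_lt _ h, chooseSub_of_lt _ (by omega), add_zero]

theorem IsPolyFun.chooseSub (b l : ℕ) : IsPolyFun fun x => chooseSub x b l := by
  by_cases h : l ≤ b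
  · simpa [_root_.chooseSub, h] using IsPolyFun.choose_add 0 (b - l)
  · simpa [_root_.chooseSub, h] using IsPolyFun.const 0

/-- The coefficient of `x^a y^b` in `(1 + x)^γ (1 + y)^δ / (1 - x y)^(γ + δ + 1)`, provided that
`K` is larger than `a` or `b`. -/
noncomputable def mixedCoeff (γ δ : ℚ) (a b K : ℕ) : ℚ :=
  ∑ l ∈ range K, chooseSub δ b l * chooseSub γ a l * Ring.choose (γ + δ + l) l

theorem mixedCoeff_symm (γ δ : ℚ) (a b K : ℕ) : mixedCoeff γ δ a b K = mixedCoeff δ γ b a K := by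
  unfold mixedCoeff
  refine sum_congr rfl fun l _ => ?_
  rw [add_comm γ δ]
  ring

/-- The identity `F_{γ+1} (1 - x y) = F_γ (1 + x)` between the generating functions. -/
theorem mixedCoeff_add_one (γ δ : ℚ) (a b K : ℕ) :
    mixedCoeff (γ + 1) δ (a + 1) (b + 1) (K + 1) = mixedCoeff γ δ (a + 1) (b + 1) (K + 1) +
      mixedCoeff γ δ a (b + 1) (K + 1) + mixedCoeff (γ + 1) δ a b K := by
  simp only [mixedCoeff, sum_range_succ' _ K, chooseSub_succ_succ, chooseSub_zero_right,
    Ring.choose_zero_right, Ring.choose_succ_succ, mul_one]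
  have key : ∑ l ∈ range K, chooseSub δ b l * chooseSub (γ + 1) a l *
        Ring.choose (γ + 1 + δ + (l + 1 : ℕ)) (l + 1) =
      ∑ l ∈ range K, chooseSub δ b l * chooseSub γ a l *
          Ring.choose (γ + δ + (l + 1 : ℕ)) (l + 1) +
        ∑ l ∈ range K, chooseSub δ b l * chooseSub γ a (l + 1) *
          Ring.choose (γ + δ + (l + 1 : ℕ)) (l + 1) +
        ∑ l ∈ range K, chooseSub δ b l * chooseSub (γ + 1) a l *
          Ring.choose (γ + 1 + δ + l) l := by
    rw [← sum_add_distrib, ← sum_add_distrib]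
    refine sum_congr rfl fun l _ => ?_
    have h : γ + 1 + δ + ((l + 1 : ℕ) : ℚ) = (γ + 1 + δ + l) + 1 := by push_cast; ring
    have h' : γ + δ + ((l + 1 : ℕ) : ℚ) = γ + 1 + δ + l := by push_cast; ring
    rw [h, h', Ring.choose_succ_succ, chooseSub_add_one]
    ring
  linear_combination key

theorem mixedCoeff_zero_left (γ δ : ℚ) (b K : ℕ) :
    mixedCoeff γ δ 0 b (K + 1) = Ring.choose δ b := by
  rw [mixedCoeff, sum_range_succ', sum_eq_zero]
  · simp [chooseSub_zero_right]
  · intro l _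
    rw [chooseSub_of_lt γ (Nat.succ_pos l)]
    ring

theorem mixedCoeff_zero_zero (a b K : ℕ) (ha : a < K) :
    mixedCoeff 0 0 a b K = Ring.choose (0 + b : ℚ) a * Ring.choose (0 + a : ℚ) b := by
  have h0 : ∀ b l : ℕ, chooseSub 0 b l = if l = b then 1 else 0 := by
    intro b l
    rcases lt_trichotomy l b with h | rfl | h
    · rw [chooseSub, if_pos h.le, if_neg h.ne, Ring.choose_zero_pos]
      omega
    · simp [chooseSub]
    · rw [chooseSub_of_lt _ h, if_neg h.ne']
  simp only [mixedCoeff, h0]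
  rw [sum_eq_single a]
  · simp only [zero_add]
    rw [Ring.choose_natCast, Ring.choose_natCast,
      Ring.choose_natCast]
    rcases lt_trichotomy a b with h | rfl | h
    · simp [h.ne, Nat.choose_eq_zero_of_lt h]
    · simp
    · simp [h.ne', Nat.choose_eq_zero_of_lt h]
  · intro l _ hl
    simp [hl]
  · intro h
    exact absurd (mem_range.2 ha) h

theorem mixedCoeff_nat (a : ℕ) : ∀ (b γ δ K : ℕ), a < K → b < K →
    mixedCoeff γ δ a b K = Ring.choose (γ + b : ℚ) a * Ring.choose (δ + a : ℚ) b := by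
  induction a with
  | zero =>
    intro b γ δ K h _
    obtain ⟨K, rfl⟩ := Nat.exists_eq_succ_of_ne_zero h.ne'
    rw [mixedCoeff_zero_left]
    simp
  | succ a iha =>
    intro b
    induction b with
    | zero =>
      intro γ δ K _ h
      obtain ⟨K, rfl⟩ := Nat.exists_eq_succ_of_ne_zero h.ne'
      rw [mixedCoeff_symm, mixedCoeff_zero_left]
      simp
    | succ b ihb =>
      intro γ δ K ha hb
      obtain ⟨K, rfl⟩ := Nat.exists_eq_succ_of_ne_zero (by omega : K ≠ 0)
      induction γ with
      | succ γ ihγ =>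
        have e1 := iha (b + 1) γ δ (K + 1) (by omega) (by omega)
        have e2 := iha b (γ + 1) δ K (by omega) (by omega)
        push_cast at ihγ e1 e2 ⊢
        rw [mixedCoeff_add_one, ihγ, e1, e2,
          show (γ : ℚ) + 1 + (b + 1) = (γ + (b + 1)) + 1 by ring,
          show (γ : ℚ) + 1 + b = γ + (b + 1) by ring, ← add_assoc (δ : ℚ), Ring.choose_succ_succ,
          Ring.choose_succ_succ]
        ring
      | zero =>
        induction δ with
        | succ δ ihδ =>
          have e1 := ihb 0 δ (K + 1) (by omega) (by omega)
          have e2 := iha b 0 (δ + 1) K (by omega) (by omega)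
          push_cast at ihδ e1 e2 ⊢
          rw [mixedCoeff_symm] at ihδ e1 e2
          rw [mixedCoeff_symm, mixedCoeff_add_one, ihδ, e1, e2,
            show (δ : ℚ) + 1 + (a + 1) = (δ + (a + 1)) + 1 by ring,
            show (δ : ℚ) + 1 + a = δ + (a + 1) by ring, ← add_assoc (0 : ℚ), Ring.choose_succ_succ,
            Ring.choose_succ_succ]
          ring
        | zero => exact_mod_cast mixedCoeff_zero_zero (a + 1) (b + 1) (K + 1) ha

/-- The coefficients of `(1 + x)^γ (1 + y)^δ / (1 - x y)^(γ + δ + 1)` are products of two binomial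
coefficients. -/
theorem mixedCoeff_eq (γ δ : ℚ) {a b K : ℕ} (ha : a < K) (hb : b < K) :
    mixedCoeff γ δ a b K = Ring.choose (γ + b) a * Ring.choose (δ + a) b := by
  have hpoly : ∀ (δ : ℚ) (a b : ℕ), IsPolyFun fun γ => mixedCoeff γ δ a b K := by
    intro δ a b
    refine IsPolyFun.sum _ fun l _ => ((IsPolyFun.const _).mul (IsPolyFun.chooseSub a l)).mul ?_
    simpa only [add_assoc] using IsPolyFun.choose_add (δ + l) l
  have h1 : ∀ δ : ℕ, mixedCoeff γ δ a b K = Ring.choose (γ + b) a * Ring.choose (δ + a : ℚ) b :=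
    fun δ => (hpoly δ a b).eq_of_nat ((IsPolyFun.choose_add _ _).mul (IsPolyFun.const _))
      (fun γ => mixedCoeff_nat a b γ δ K ha hb) γ
  simp only [mixedCoeff_symm γ] at h1 ⊢
  exact (hpoly γ b a).eq_of_nat ((IsPolyFun.const _).mul (IsPolyFun.choose_add _ _)) h1 δ

/-- The identity between binomial coefficients to which the pentagon relation amounts. -/
theorem sum_choose_mul_choose_mul_choose (α β : ℚ) {a b K : ℕ} (ha : a < K) (hb : b < K) :
    ∑ l ∈ range K, chooseSub α b l * Ring.choose (α + β - b + l) l * chooseSub (β - b) a l =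
      Ring.choose β a * Ring.choose (α + a) b := by
  have h := mixedCoeff_eq (β - b) α ha hb
  rw [sub_add_cancel] at h
  rw [← h, mixedCoeff]
  refine sum_congr rfl fun l _ => ?_
  rw [show α + β - b + l = β - b + α + l by ring]
  ring

end BinomialIdentity

/-! ### Dilogarithm elements as operators and the pentagon relation -/

section DilogarithmOperators

open Finset FunMod

attribute [local instance] LieRing.ofAssociativeRing

variable {N : Type*} [AddCommGroup N] {b : Module.Basis (Fin 2) ℤ N}
  {k : Type*} [Field k] {ω : SkewForm N} {L : CofiniteIdeal b}

theorem VanishesFrom.mono {K K' : ℕ} (h : VanishesFrom k L K) (hK : K ≤ K') :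
    VanishesFrom k L K' := fun f m hm => h f m (by omega)

theorem VanishesFrom.apply_add_nsmul {K : ℕ} (h : VanishesFrom k L K) (f : FunMod k L)
    (m : NNonneg b) {i : ℕ} (hi : K ≤ i) (n : NPlus b) : f.1 (m + i • NPlus.toNonneg n) = 0 := by
  refine h f _ ?_
  rw [NNonneg.deg_add, NNonneg.deg_nsmul, NNonneg.deg_toNonneg]
  have h1 := NNonneg.deg_nonneg m
  have h2 := NPlus.deg_pos n
  have h3 : (K : ℤ) ≤ i := by exact_mod_cast hi
  nlinarith

theorem VanishesFrom.shift_pow_eq_zero {K : ℕ} (h : VanishesFrom k L K) (n : NPlus b) :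
    (FunMod.shift n : Module.End k (FunMod k L)) ^ K = 0 :=
  LinearMap.ext fun f => FunMod.ext fun m => by
    rw [shift_pow_apply, h.apply_add_nsmul f m le_rfl n]
    rfl

theorem FunMod.sum_apply {ι : Type*} (s : Finset ι) (f : ι → FunMod k L) (m : NNonneg b) :
    (∑ i ∈ s, f i).1 m = ∑ i ∈ s, (f i).1 m := by
  classical
  induction s using Finset.induction_on with
  | empty => rfl
  | insert a s ha ih =>
    rw [sum_insert ha, sum_insert ha, ← ih]
    rfl

theorem weight_add_nsmul (m : NNonneg b) (i : ℕ) (n n' : NPlus b) :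
    weight ω (m + i • NPlus.toNonneg n) n' = weight ω m n' + i * ω.form (n : N) (n' : N) := by
  have h : ((m + i • NPlus.toNonneg n : NNonneg b) : N) = m + i • (n : N) := rfl
  simp only [weight, h, map_add, map_nsmul, LinearMap.add_apply, LinearMap.smul_apply,
    nsmul_eq_mul]
  ring

theorem SkewForm.form_self (ω : SkewForm N) (x : N) : ω.form x x = 0 := by
  have := ω.skew x x
  linarith

theorem weight_add (m : NNonneg b) (n n' : NPlus b) :
    weight ω m (n + n') = weight ω m n + weight ω m n' := by
  simp only [weight, NPlus.deg_add, AddMemClass.coe_add, map_add]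
  push_cast
  ring

theorem weight_mul (m : NNonneg b) (j : ℕ+) (n : NPlus b) :
    weight ω m (NPlus.mul j n) = (j : ℕ) * weight ω m n := by
  have h : ((NPlus.mul j n : NPlus b) : N) = (j : ℕ) • (n : N) := rfl
  simp only [weight, NPlus.deg_mul, h, map_nsmul, nsmul_eq_mul]
  push_cast
  ring

variable [CharZero k]

theorem FunMod.rat_smul_apply (q : ℚ) (f : FunMod k L) (m : NNonneg b) :
    (q • f).1 m = (q : k) * f.1 m := rfl

theorem nilLog_shift_apply {K : ℕ} (hK : VanishesFrom k L K) (n : NPlus b) (f : FunMod k L)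
    (m : NNonneg b) : (nilLog (FunMod.shift n) f).1 m =
      ∑ l ∈ range K, (((-1) ^ (l + 1) / l : ℚ) : k) * f.1 (m + l • NPlus.toNonneg n) := by
  rw [nilLog_eq_sum (hK.shift_pow_eq_zero n), LinearMap.sum_apply, FunMod.sum_apply]
  refine sum_congr rfl fun l _ => ?_
  rw [LinearMap.smul_apply, FunMod.rat_smul_apply, shift_pow_apply]

/-- The coefficients `(-1)^(j+1)/j²` of `[n]`, times the factor `j` in `{·, jn} + deg (jn)`, give the
series `log (1 + T)` in the shift `T` by `n`. -/
theorem torusModRep_dilogLie_apply (n : NPlus b) (f : FunMod k L) (m : NNonneg b) :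
    (torusModRep k ω L ((dilogLie k ω n).1 L) f).1 m =
      (weight ω m n : k) * (nilLog (FunMod.shift n) f).1 m := by
  obtain ⟨K, hK⟩ := exists_vanishesFrom k L
  let v : ℕ → k := fun l => (weight ω m n : k) *
    ((((-1) ^ (l + 1) / l : ℚ) : k) * f.1 (m + l • NPlus.toNonneg n))
  let φ : TorusLieMod k ω L →ₗ[k] k :=
    { toFun := fun x => (torusModRep k ω L x f).1 m
      map_add' := fun x y => by rw [map_add]; rfl
      map_smul' := fun a x => by rw [map_smul]; rfl }
  have h1 : ∀ j : ℕ+, φ (((-1 : k) ^ ((j : ℕ) + 1) / ((j : ℕ) : k) ^ 2) •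
      TorusLieMod.mk k ω L (TorusLie.X k ω (NPlus.mul j n))) = v (j : ℕ) := by
    intro j
    rw [map_smul]
    change _ * (torusModRep k ω L (TorusLieMod.mk k ω L _) f).1 m = _
    rw [torusModRep_mk, torusRep_X, genOp_apply, weight_mul, NPlus.toNonneg_mul]
    have hj : ((j : ℕ) : k) ≠ 0 := by exact_mod_cast j.ne_zero
    simp only [v]
    push_cast
    field_simp
  have h2 : φ ((dilogLie k ω n).1 L) = ∑ᶠ j : ℕ+, v (j : ℕ) := by
    change φ (∑ᶠ j : ℕ+, _) = _
    rw [← LinearMap.toAddMonoidHom_coe,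
      AddMonoidHom.map_finsum _ (finite_support_dilogTerm ω _ L n)]
    exact finsum_congr h1
  change φ ((dilogLie k ω n).1 L) = _
  rw [h2, nilLog_shift_apply (hK.mono (Nat.le_succ K)), mul_sum]
  have h3 : ∑ᶠ j : ℕ+, v (j : ℕ) = ∑ᶠ i : ℕ, v (i + 1) := by
    rw [← finsum_comp_equiv Equiv.pnatEquivNat.symm]
    rfl
  rw [h3, finsum_eq_sum_of_support_subset (s := range K), sum_range_succ']
  · simp [v]
  · intro i hi
    rw [coe_range, Set.mem_Iio]
    by_contra h
    refine hi ?_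
    change (weight ω m n : k) * (_ * f.1 _) = 0
    rw [hK.apply_add_nsmul f m (by omega) n, mul_zero, mul_zero]

variable (k ω L) in
/-- The action of `[n]^c` on `FunMod k L`. -/
noncomputable def dilogOp (n : NPlus b) (c : ℚ) : Module.End k (FunMod k L) :=
  IsNilpotent.exp (torusModRep k ω L ((c : k) • (dilogLie k ω n).1 L))

/-- `[n]^c` acts by `f ↦ ∑ᵢ (c ({·, n} + deg n) choose i) f (· + i n)`: on the dual basis `x^m`
this is the substitution `x^m ↦ x^m (1 + x^n)^(c ({m, n} + deg n))`. -/
theorem dilogOp_apply {K : ℕ} (hK : VanishesFrom k L K) (n : NPlus b) (c : ℚ) (f : FunMod k L)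
    (m : NNonneg b) : (dilogOp k ω L n c f).1 m =
      ∑ i ∈ range K,
        ((Ring.choose (c * weight ω m n) i : ℚ) : k) * f.1 (m + i • NPlus.toNonneg n) := by
  set R := torusModRep k ω L ((c : k) • (dilogLie k ω n).1 L) with hR
  set T : Module.End k (FunMod k L) := FunMod.shift n with hT
  have hTK : T ^ K = 0 := hK.shift_pow_eq_zero n
  -- `R` is `log (1 + T)` times a function that is invariant under `T`; so at the point `m` the
  -- powers of `R` agree with those of a scalar multiple of `log (1 + T)`.
  have hRf : ∀ (f : FunMod k L) (m : NNonneg b),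
      (R f).1 m = ((c * weight ω m n : ℚ) : k) * (nilLog T f).1 m := by
    intro f m
    rw [hR, map_smul]
    change (c : k) * _ = _
    rw [torusModRep_dilogLie_apply]
    push_cast
    ring
  have hRj : ∀ (j : ℕ) (m : NNonneg b),
      ((R ^ j) f).1 m = ((c * weight ω m n : ℚ) : k) ^ j * ((nilLog T ^ j) f).1 m := by
    intro j
    induction j with
    | zero => intro m; simp
    | succ j ih =>
      intro m
      rw [pow_succ', pow_succ' (nilLog T), Module.End.mul_apply, Module.End.mul_apply, hRf,
        nilLog_shift_apply hK, nilLog_shift_apply hK, pow_succ', mul_assoc, mul_sum (range K) _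
        ((_ : k) ^ j)]
      congr 1
      refine sum_congr rfl fun l _ => ?_
      rw [ih, weight_add_nsmul, SkewForm.form_self, mul_zero, add_zero]
      ring
  obtain ⟨J, hJ⟩ := isNilpotent_torusModRep ((c : k) • (dilogLie k ω n).1 L)
  obtain ⟨J', hJ'⟩ := isNilpotent_nilLog (⟨K, hTK⟩ : IsNilpotent T)
  have h1 : R ^ (max J J') = 0 := pow_eq_zero_of_le (le_max_left _ _) hJ
  have h2 : ((c * weight ω m n : ℚ) • nilLog T) ^ (max J J') = 0 := by
    rw [smul_pow, pow_eq_zero_of_le (le_max_right _ _) hJ', smul_zero]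
  have h3 : (IsNilpotent.exp R f).1 m =
      (IsNilpotent.exp ((c * weight ω m n : ℚ) • nilLog T) f).1 m := by
    rw [IsNilpotent.exp_eq_sum h1, IsNilpotent.exp_eq_sum h2, LinearMap.sum_apply,
      LinearMap.sum_apply, FunMod.sum_apply, FunMod.sum_apply]
    refine sum_congr rfl fun j _ => ?_
    rw [LinearMap.smul_apply, LinearMap.smul_apply, FunMod.rat_smul_apply, FunMod.rat_smul_apply,
      hRj, smul_pow, LinearMap.smul_apply, FunMod.rat_smul_apply]
    push_cast
    rfl
  rw [dilogOp, ← hR, h3, exp_smul_nilLog hTK, LinearMap.sum_apply, FunMod.sum_apply]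
  refine sum_congr rfl fun i _ => ?_
  rw [LinearMap.smul_apply, FunMod.rat_smul_apply, shift_pow_apply]

theorem dilogOp_add (n : NPlus b) (c d : ℚ) :
    dilogOp k ω L n (c + d) = dilogOp k ω L n c * dilogOp k ω L n d := by
  rw [dilogOp, dilogOp, dilogOp, ← IsNilpotent.exp_add_of_commute _ (isNilpotent_torusModRep _)
    (isNilpotent_torusModRep _), ← map_add, ← add_smul, Rat.cast_add]
  rw [map_smul, map_smul]
  exact ((Commute.refl _).smul_left _).smul_right _

theorem commute_exp {A : Type*} [Ring A] [Algebra ℚ A] {x y : A} (h : Commute x y) :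
    Commute (IsNilpotent.exp x) (IsNilpotent.exp y) :=
  Commute.sum_left _ _ _ fun _ _ => Commute.sum_right _ _ _ fun _ _ =>
    (((h.pow_pow _ _).smul_left _).smul_right _)

theorem dilogOp_commute {n n' : NPlus b} (h : ω.form (n : N) (n' : N) = 0) (c d : ℚ) :
    Commute (dilogOp k ω L n c) (dilogOp k ω L n' d) := by
  obtain ⟨K, hK⟩ := exists_vanishesFrom k L
  have h' : ω.form (n' : N) (n : N) = 0 := by rw [ω.skew, h, neg_zero]
  refine commute_exp ?_
  rw [map_smul, map_smul]
  refine Commute.smul_left (Commute.smul_right ?_ _) _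
  refine LinearMap.ext fun f => FunMod.ext fun m => ?_
  simp only [Module.End.mul_apply, torusModRep_dilogLie_apply, nilLog_shift_apply hK,
    weight_add_nsmul, h, h', mul_zero, add_zero]
  simp only [mul_sum]
  rw [sum_comm]
  refine sum_congr rfl fun i _ => sum_congr rfl fun j _ => ?_
  rw [add_right_comm m]
  ring

theorem dilogOp_eq_one {K : ℕ} (hK : VanishesFrom k L K) {n : NPlus b}
    (hn : (K : ℤ) ≤ NPlus.deg n) (c : ℚ) : dilogOp k ω L n c = 1 := by
  have h : torusModRep k ω L ((dilogLie k ω n).1 L) = 0 := by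
    refine LinearMap.ext fun f => FunMod.ext fun m => ?_
    rw [torusModRep_dilogLie_apply, nilLog_shift_apply hK, sum_eq_zero, mul_zero]
    · rfl
    · intro l _
      cases l with
      | zero => simp
      | succ l =>
        rw [hK f _, mul_zero]
        rw [NNonneg.deg_add, NNonneg.deg_nsmul, NNonneg.deg_toNonneg]
        have h1 := NNonneg.deg_nonneg m
        have h2 := NPlus.deg_pos n
        push_cast
        nlinarith [(Nat.cast_nonneg l : (0 : ℤ) ≤ l)]
  rw [dilogOp, map_smul, h, smul_zero, IsNilpotent.exp_zero]

omit [CharZero k] in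
/-- Reindexing of a sum by `j = i + l`. -/
theorem sum_mul_apply_add {K : ℕ} (φ F : ℕ → k) (hF : ∀ i, K ≤ i → F i = 0) (l : ℕ) :
    ∑ i ∈ range K, φ i * F (i + l) =
      ∑ j ∈ range K, (if l ≤ j then φ (j - l) else 0) * F j := by
  by_cases h : l ≤ K
  · obtain ⟨d, rfl⟩ := Nat.exists_eq_add_of_le h
    rw [sum_range_add (fun j => (if l ≤ j then φ (j - l) else 0) * F j), sum_eq_zero (s := range l),
      zero_add, add_comm l d, sum_range_add (fun i => φ i * F (i + l)),
      sum_eq_zero (s := range l) (f := fun x => φ (d + x) * F (d + x + l)), add_zero]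
    · refine sum_congr rfl fun i _ => ?_
      rw [if_pos (by omega), Nat.add_sub_cancel_left, add_comm]
    · intro i _
      rw [hF _ (by omega), mul_zero]
    · intro i hi
      rw [mem_range] at hi
      rw [if_neg (by omega), zero_mul]
  · rw [sum_eq_zero, sum_eq_zero]
    · intro i hi
      rw [mem_range] at hi
      rw [if_neg (by omega), zero_mul]
    · intro i _
      rw [hF _ (by omega), mul_zero]

/-- The pentagon relation `[n']^c [n]^c = [n]^c [n + n']^c [n']^c` for `{n', n} = 1/c`. -/
theorem dilogOp_pentagon {n n' : NPlus b} {c : ℚ} (hc : c ≠ 0)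
    (h : ω.form (n' : N) (n : N) = c⁻¹) :
    dilogOp k ω L n' c * dilogOp k ω L n c =
      dilogOp k ω L n c * dilogOp k ω L (n + n') c * dilogOp k ω L n' c := by
  obtain ⟨K, hK⟩ := exists_vanishesFrom k L
  refine LinearMap.ext fun f => FunMod.ext fun m => ?_
  have h' : ω.form (n : N) (n' : N) = -c⁻¹ := by rw [ω.skew, h]
  set α := c * weight ω m n with hα
  set β := c * weight ω m n' with hβ
  set g : ℕ → ℕ → k := fun i j =>
    f.1 (m + i • NPlus.toNonneg n' + j • NPlus.toNonneg n) with hg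
  have hg1 : ∀ i j, K ≤ i → g i j = 0 := by
    intro i j hi
    simp only [hg]
    rw [add_right_comm]
    exact hK.apply_add_nsmul f _ hi n'
  have hg2 : ∀ i j, K ≤ j → g i j = 0 := fun i j hj => hK.apply_add_nsmul f _ hj n
  have hL : (dilogOp k ω L n' c (dilogOp k ω L n c f)).1 m =
      ∑ i ∈ range K, ((Ring.choose β i : ℚ) : k) *
        ∑ j ∈ range K, ((Ring.choose (α + i) j : ℚ) : k) * g i j := by
    rw [dilogOp_apply hK]
    refine sum_congr rfl fun i _ => ?_
    rw [dilogOp_apply hK, weight_add_nsmul, h, show c * (weight ω m n + i * c⁻¹) = α + i by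
      rw [hα]; field_simp]
  have hR : (dilogOp k ω L n c (dilogOp k ω L (n + n') c (dilogOp k ω L n' c f))).1 m =
      ∑ i ∈ range K, ((Ring.choose α i : ℚ) : k) *
        ∑ l ∈ range K, ((Ring.choose (α + β - i) l : ℚ) : k) *
          ∑ j ∈ range K, ((Ring.choose (β - (i + l : ℕ)) j : ℚ) : k) * g (j + l) (i + l) := by
    rw [dilogOp_apply hK]
    refine sum_congr rfl fun i _ => ?_
    rw [dilogOp_apply hK]
    congr 1
    refine sum_congr rfl fun l _ => ?_
    rw [dilogOp_apply hK]
    congr 1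
    · congr 2
      rw [weight_add, weight_add_nsmul, weight_add_nsmul, h', SkewForm.form_self, hα, hβ]
      field_simp
      ring
    · refine sum_congr rfl fun j _ => ?_
      congr 1
      · congr 2
        rw [weight_add_nsmul, weight_add_nsmul, h', AddMemClass.coe_add, map_add,
          LinearMap.add_apply, h', SkewForm.form_self, hβ]
        push_cast
        field_simp
        ring
      · refine congrArg f.1 ?_
        rw [NPlus.toNonneg_add, nsmul_add, add_nsmul, add_nsmul]
        abel
  rw [Module.End.mul_apply, Module.End.mul_apply, Module.End.mul_apply, hL, hR]
  have hR2 : ∑ i ∈ range K, ((Ring.choose α i : ℚ) : k) *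
        ∑ l ∈ range K, ((Ring.choose (α + β - i) l : ℚ) : k) *
          ∑ j ∈ range K, ((Ring.choose (β - (i + l : ℕ)) j : ℚ) : k) * g (j + l) (i + l) =
      ∑ l ∈ range K, ∑ s ∈ range K, ∑ r ∈ range K,
        ((chooseSub α s l * Ring.choose (α + β - s + l) l * chooseSub (β - s) r l : ℚ) : k) *
          g r s := by
    have hd : ∀ i, ((Ring.choose α i : ℚ) : k) *
        ∑ l ∈ range K, ((Ring.choose (α + β - i) l : ℚ) : k) *
          ∑ j ∈ range K, ((Ring.choose (β - (i + l : ℕ)) j : ℚ) : k) * g (j + l) (i + l) =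
        ∑ l ∈ range K, ((Ring.choose α i : ℚ) : k) * ((Ring.choose (α + β - i) l : ℚ) : k) *
          ∑ j ∈ range K, ((Ring.choose (β - (i + l : ℕ)) j : ℚ) : k) * g (j + l) (i + l) := by
      intro i
      rw [mul_sum]
      exact sum_congr rfl fun l _ => (mul_assoc _ _ _).symm
    rw [sum_congr rfl fun i _ => hd i, sum_comm]
    refine sum_congr rfl fun l _ => ?_
    rw [sum_mul_apply_add
      (fun i => ((Ring.choose α i : ℚ) : k) * ((Ring.choose (α + β - i) l : ℚ) : k))
      (fun s => ∑ j ∈ range K, ((Ring.choose (β - s) j : ℚ) : k) * g (j + l) s)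
      (fun s hs => sum_eq_zero fun j _ => by rw [hg2 _ _ hs, mul_zero])]
    refine sum_congr rfl fun s _ => ?_
    rw [sum_mul_apply_add (fun j => ((Ring.choose (β - s) j : ℚ) : k)) (fun r => g r s)
      (fun r hr => hg1 _ _ hr), mul_sum]
    refine sum_congr rfl fun r _ => ?_
    by_cases hs : l ≤ s <;> by_cases hr : l ≤ r
    · simp only [chooseSub, hs, hr, if_true]
      push_cast [Nat.cast_sub hs]
      rw [show α + β - s + l = α + β - (s - l) by ring]
      ring
    all_goals simp [chooseSub, hs, hr]
  -- It remains to compare the coefficients of `f (m + r n' + s n)`.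
  rw [hR2, sum_comm]
  simp only [mul_sum]
  rw [sum_comm]
  refine sum_congr rfl fun s hs => ?_
  rw [sum_comm]
  refine sum_congr rfl fun r hr => ?_
  rw [← sum_mul, ← Rat.cast_sum,
    sum_choose_mul_choose_mul_choose α β (mem_range.1 hr) (mem_range.1 hs)]
  push_cast
  ring

end DilogarithmOperators

/-! ### Products of sequences in a monoid -/

section OrderedProducts

variable {A : Type*} [Monoid A]

/-- The product `u₀ u₁ ⋯ u_{K-1}`. -/
def prodRight (u : ℕ → A) (K : ℕ) : A := ((List.range K).map u).prod

/-- The product `u_{K-1} ⋯ u₁ u₀`. -/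
def prodLeft (u : ℕ → A) (K : ℕ) : A := ((List.range K).reverse.map u).prod

theorem prodRight_zero (u : ℕ → A) : prodRight u 0 = 1 := rfl

theorem prodLeft_zero (u : ℕ → A) : prodLeft u 0 = 1 := rfl

theorem prodRight_succ (u : ℕ → A) (K : ℕ) : prodRight u (K + 1) = prodRight u K * u K := by
  simp [prodRight, List.range_succ]

theorem prodLeft_succ (u : ℕ → A) (K : ℕ) : prodLeft u (K + 1) = u K * prodLeft u K := by
  simp [prodLeft, List.range_succ]

theorem prodRight_succ' (u : ℕ → A) (K : ℕ) :
    prodRight u (K + 1) = u 0 * prodRight (fun p => u (p + 1)) K := by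
  simp [prodRight, List.range_succ_eq_map, Function.comp_def]

theorem prodRight_eq_of_le {u : ℕ → A} {K K' : ℕ} (h : ∀ p, K ≤ p → u p = 1) (hK : K ≤ K') :
    prodRight u K' = prodRight u K := by
  induction K', hK using Nat.le_induction with
  | base => rfl
  | succ K' hK ih => rw [prodRight_succ, ih, h _ hK, mul_one]

theorem prodLeft_eq_of_le {u : ℕ → A} {K K' : ℕ} (h : ∀ p, K ≤ p → u p = 1) (hK : K ≤ K') :
    prodLeft u K' = prodLeft u K := by
  induction K', hK using Nat.le_induction with
  | base => rfl
  | succ K' hK ih => rw [prodLeft_succ, ih, h _ hK, one_mul]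

theorem mul_prodRight {x : A} {u v : ℕ → A} (h : ∀ p, x * u p = v p * x) (K : ℕ) :
    x * prodRight u K = prodRight v K * x := by
  induction K with
  | zero => simp [prodRight_zero]
  | succ K ih => rw [prodRight_succ, prodRight_succ, ← mul_assoc, ih, mul_assoc, h, mul_assoc]

theorem prodLeft_mul {x : A} {u v : ℕ → A} (h : ∀ p, u p * x = x * v p) (K : ℕ) :
    prodLeft u K * x = x * prodLeft v K := by
  induction K with
  | zero => simp [prodLeft_zero]
  | succ K ih =>
    rw [prodLeft_succ, prodLeft_succ, mul_assoc, ih, ← mul_assoc, h, mul_assoc]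

theorem prod_map_filter_eq {u : ℕ → A} {P : ℕ → Prop} [DecidablePred P]
    (h : ∀ p, ¬ P p → u p = 1) (l : List ℕ) : ((l.filter P).map u).prod = (l.map u).prod := by
  induction l with
  | nil => rfl
  | cons a l ih =>
    by_cases ha : P a
    · simp [ha, ih]
    · simp [ha, ih, h a ha]

/-- For commuting factors that are eventually `1`, any finite product over distinct indices that
include the nontrivial ones equals `u₀ u₁ ⋯ u_{K-1}`. -/
theorem prod_map_eq_prodRight {u : ℕ → A} {K : ℕ} (h : ∀ p, K ≤ p → u p = 1)
    (hc : ∀ p q, Commute (u p) (u q)) {l : List ℕ} (hl : l.Nodup) (hK : ∀ p < K, p ∈ l) :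
    (l.map u).prod = prodRight u K := by
  rw [← prod_map_filter_eq (P := fun p => p < K) (fun p hp => h p (not_lt.1 hp)), prodRight]
  refine List.Perm.prod_eq' (List.Perm.map u ?_) ?_
  · refine (List.perm_ext_iff_of_nodup (hl.filter _) List.nodup_range).2 fun p => ?_
    simp only [List.mem_filter, decide_eq_true_eq, List.mem_range]
    exact ⟨fun hp => hp.2, fun hp => ⟨hK p hp, hp⟩⟩
  · exact List.pairwise_map.2 (List.pairwise_of_forall fun p q => hc p q)

end OrderedProducts

/-! ### The factorization in the groups `G_L` -/

section FiniteFactorization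

variable {N : Type*} [AddCommGroup N] {b : Module.Basis (Fin 2) ℤ N}
  {k : Type*} [Field k] [CharZero k] {ω : SkewForm N} {L : CofiniteIdeal b}

theorem NPlus.addMul_zero (n m : NPlus b) : NPlus.addMul n 0 m = n :=
  Subtype.ext (by simp [NPlus.addMul])

theorem NPlus.addMul_succ (n m : NPlus b) (p : ℕ) :
    NPlus.addMul n (p + 1) m = m + NPlus.addMul n p m :=
  Subtype.ext (by
    change (n : N) + (p + 1) • (m : N) = m + ((n : N) + p • (m : N))
    rw [succ_nsmul]
    abel)

theorem NPlus.deg_addMul (n m : NPlus b) (p : ℕ) :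
    NPlus.deg (NPlus.addMul n p m) = NPlus.deg n + p * NPlus.deg m := by
  induction p with
  | zero => simp [NPlus.addMul_zero]
  | succ p ih => rw [NPlus.addMul_succ, NPlus.deg_add, ih]; push_cast; ring

theorem SkewForm.form_addMul_right (n m : NPlus b) (p : ℕ) :
    ω.form (m : N) (NPlus.addMul n p m : NPlus b) = ω.form (m : N) (n : N) := by
  change ω.form (m : N) ((n : N) + p • (m : N)) = _
  rw [map_add, map_nsmul, SkewForm.form_self, smul_zero, add_zero]

theorem SkewForm.form_addMul_left (n m : NPlus b) (p : ℕ) :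
    ω.form (NPlus.addMul n p m : NPlus b) (m : N) = ω.form (n : N) (m : N) := by
  rw [ω.skew, SkewForm.form_addMul_right, ← ω.skew]

theorem SkewForm.form_mul_mul (i j : ℕ+) (m : NPlus b) :
    ω.form (NPlus.mul i m : NPlus b) (NPlus.mul j m : NPlus b) = 0 := by
  change ω.form ((i : ℕ) • (m : N)) ((j : ℕ) • (m : N)) = 0
  rw [map_nsmul, map_nsmul, LinearMap.smul_apply, SkewForm.form_self, smul_zero, smul_zero]

theorem dilogOp_mul_self (n : NPlus b) (c : ℚ) :
    dilogOp k ω L n c * dilogOp k ω L n c = dilogOp k ω L n (2 * c) := by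
  rw [← dilogOp_add, two_mul]

/-- `[n']^{2c} [n]^c = [n]^c [n + n']^{2c} [n + 2n']^c [n']^{2c}` for `{n', n} = 1/c`. -/
theorem dilogOp_two_mul_mul {n n' : NPlus b} {c : ℚ} (hc : c ≠ 0)
    (h : ω.form (n' : N) (n : N) = c⁻¹) :
    dilogOp k ω L n' (2 * c) * dilogOp k ω L n c =
      dilogOp k ω L n c * dilogOp k ω L (n' + n) (2 * c) * dilogOp k ω L (n' + (n' + n)) c *
        dilogOp k ω L n' (2 * c) := by
  have h1 := dilogOp_pentagon (k := k) (L := L) hc h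
  have h' : ω.form (n' : N) ((n' + n : NPlus b) : N) = c⁻¹ := by
    rw [AddMemClass.coe_add, map_add, SkewForm.form_self, zero_add, h]
  have h2 := dilogOp_pentagon (k := k) (L := L) hc h'
  rw [add_comm n n'] at h1
  rw [add_comm (n' + n) n'] at h2
  rw [← dilogOp_mul_self n', ← dilogOp_mul_self (n' + n)]
  simp only [mul_assoc] at h1 h2 ⊢
  rw [h1, ← mul_assoc, h1]
  simp only [mul_assoc]
  rw [← mul_assoc (dilogOp k ω L n' c) (dilogOp k ω L (n' + n) c), h2]
  simp only [mul_assoc]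

/-- `[n']^c [n]^{2c} = [n]^{2c} [2n + n']^c [n + n']^{2c} [n']^c` for `{n', n} = 1/c`. -/
theorem dilogOp_mul_two_mul {n n' : NPlus b} {c : ℚ} (hc : c ≠ 0)
    (h : ω.form (n' : N) (n : N) = c⁻¹) :
    dilogOp k ω L n' c * dilogOp k ω L n (2 * c) =
      dilogOp k ω L n (2 * c) * dilogOp k ω L (n + (n + n')) c * dilogOp k ω L (n + n') (2 * c) *
        dilogOp k ω L n' c := by
  have h1 := dilogOp_pentagon (k := k) (L := L) hc h
  have h' : ω.form ((n + n' : NPlus b) : N) (n : N) = c⁻¹ := by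
    rw [AddMemClass.coe_add, map_add, LinearMap.add_apply, SkewForm.form_self, zero_add, h]
  have h2 := dilogOp_pentagon (k := k) (L := L) hc h'
  rw [← dilogOp_mul_self n, ← dilogOp_mul_self (n + n')]
  simp only [mul_assoc] at h1 h2 ⊢
  rw [← mul_assoc, h1]
  simp only [mul_assoc]
  rw [h1, ← mul_assoc (dilogOp k ω L (n + n') c) (dilogOp k ω L n c), h2]
  simp only [mul_assoc]

variable (k ω L) in
/-- The operators of `[n + p m]^c`, for `p ≥ 0`, along the ray from `n` in the direction `m`. -/
noncomputable abbrev rayOp (n m : NPlus b) (c : ℚ) (p : ℕ) : Module.End k (FunMod k L) :=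
  dilogOp k ω L (NPlus.addMul n p m) c

variable (k ω L) in
/-- The operators of `[2^p m]^{4c/2^p}`, for `p ≥ 0`. -/
noncomputable abbrev centralOp (m : NPlus b) (c : ℚ) (p : ℕ) : Module.End k (FunMod k L) :=
  dilogOp k ω L (NPlus.mul (2 ^ p) m) (4 * c / 2 ^ p)

theorem rayOp_zero (n m : NPlus b) (c : ℚ) : rayOp k ω L n m c 0 = dilogOp k ω L n c := by
  rw [rayOp, NPlus.addMul_zero]

/-- Moving `[m]^{2c}` to the right of the product of every other vector of a ray inserts the missing
vectors. -/
theorem dilogOp_mul_prodRight {n m : NPlus b} {c : ℚ} (hc : c ≠ 0)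
    (h : ω.form (m : N) (n : N) = c⁻¹) (K : ℕ) :
    dilogOp k ω L m (2 * c) * prodRight (fun p => rayOp k ω L n m c (2 * p + 1)) K =
      prodRight (fun p => rayOp k ω L n m c (2 * p + 1) * rayOp k ω L n m (2 * c) (2 * p + 2) *
        rayOp k ω L n m c (2 * p + 3)) K * dilogOp k ω L m (2 * c) := by
  refine mul_prodRight (fun p => ?_) K
  have h1 : ω.form (m : N) ((NPlus.addMul n (2 * p + 1) m : NPlus b) : N) = c⁻¹ := by
    rw [SkewForm.form_addMul_right, h]
  rw [dilogOp_two_mul_mul hc h1, ← NPlus.addMul_succ, ← NPlus.addMul_succ]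

/-- The factors with exponent `c` that have the same base are adjacent and combine to exponent
`2c`. -/
theorem mul_prodRight_eq_prodRight (n m : NPlus b) (c : ℚ) (K : ℕ) :
    dilogOp k ω L n (2 * c) * rayOp k ω L n m c 1 *
      prodRight (fun p => rayOp k ω L n m c (2 * p + 1) * rayOp k ω L n m (2 * c) (2 * p + 2) *
        rayOp k ω L n m c (2 * p + 3)) K =
      prodRight (rayOp k ω L n m (2 * c)) (2 * K + 1) * rayOp k ω L n m c (2 * K + 1) := by
  induction K with
  | zero => simp [prodRight_succ, prodRight_zero, rayOp_zero]
  | succ K ih =>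
    rw [prodRight_succ, ← mul_assoc, ih, show 2 * (K + 1) + 1 = 2 * K + 1 + 1 + 1 by ring,
      prodRight_succ _ (2 * K + 1 + 1), prodRight_succ _ (2 * K + 1)]
    simp only [rayOp, mul_assoc]
    rw [← mul_assoc (dilogOp k ω L (NPlus.addMul n (2 * K + 1) m) c), dilogOp_mul_self]

theorem prodLeft_mul_dilogOp {n m : NPlus b} {c : ℚ} (hc : c ≠ 0)
    (h : ω.form (n : N) (m : N) = c⁻¹) (K : ℕ) :
    prodLeft (fun p => rayOp k ω L n m c (2 * p)) K * dilogOp k ω L m (2 * c) =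
      dilogOp k ω L m (2 * c) * prodLeft (fun p => rayOp k ω L n m c (2 * p + 2) *
        rayOp k ω L n m (2 * c) (2 * p + 1) * rayOp k ω L n m c (2 * p)) K := by
  refine prodLeft_mul (fun p => ?_) K
  have h1 : ω.form ((NPlus.addMul n (2 * p) m : NPlus b) : N) (m : N) = c⁻¹ := by
    rw [SkewForm.form_addMul_left, h]
  rw [dilogOp_mul_two_mul hc h1, ← NPlus.addMul_succ, ← NPlus.addMul_succ]
  simp only [mul_assoc]

theorem prodLeft_mul_eq_prodLeft (n m : NPlus b) (c : ℚ) (K : ℕ) :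
    prodLeft (fun p => rayOp k ω L n m c (2 * p + 2) *
        rayOp k ω L n m (2 * c) (2 * p + 1) * rayOp k ω L n m c (2 * p)) K * dilogOp k ω L n c =
      rayOp k ω L n m c (2 * K) * prodLeft (rayOp k ω L n m (2 * c)) (2 * K) := by
  induction K with
  | zero => simp [prodLeft_zero, rayOp_zero]
  | succ K ih =>
    rw [prodLeft_succ, mul_assoc, ih, show 2 * (K + 1) = 2 * K + 1 + 1 by ring,
      prodLeft_succ _ (2 * K + 1), prodLeft_succ _ (2 * K)]
    simp only [rayOp, mul_assoc]
    rw [← mul_assoc (dilogOp k ω L (NPlus.addMul n (2 * K) m) c), dilogOp_mul_self]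

theorem centralOp_commute (m : NPlus b) (c : ℚ) (p q : ℕ) :
    Commute (centralOp k ω L m c p) (centralOp k ω L m c q) :=
  dilogOp_commute (SkewForm.form_mul_mul _ _ _) _ _

theorem NPlus.mul_one (m : NPlus b) : NPlus.mul 1 m = m := Subtype.ext (by simp [NPlus.mul])

/-- The two factors `[m]^{2c}` make up the factor `p = 0`, and the factors over `2m` are those with
`p > 0`. -/
theorem mul_centralOp_mul {m m₂ : NPlus b} (hm : m₂ = NPlus.mul 2 m) (c : ℚ) (K : ℕ) :
    dilogOp k ω L m (2 * c) * prodRight (centralOp k ω L m₂ (c / 2)) K * dilogOp k ω L m (2 * c) =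
      prodRight (centralOp k ω L m c) (K + 1) := by
  have h : centralOp k ω L m₂ (c / 2) = fun p => centralOp k ω L m c (p + 1) := by
    funext p
    have h1 : NPlus.mul (2 ^ p) m₂ = NPlus.mul (2 ^ (p + 1)) m := by
      refine Subtype.ext ?_
      rw [hm]
      change ((2 ^ p : ℕ+) : ℕ) • ((2 : ℕ+) : ℕ) • (m : N) = ((2 ^ (p + 1) : ℕ+) : ℕ) • (m : N)
      rw [smul_smul, pow_succ, PNat.mul_coe]
    simp only [centralOp, h1]
    congr 1
    rw [pow_succ]
    field_simp
  have hc : ∀ p, dilogOp k ω L m (2 * c) * centralOp k ω L m c p =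
      centralOp k ω L m c p * dilogOp k ω L m (2 * c) := by
    intro p
    have h1 := SkewForm.form_mul_mul (ω := ω) 1 (2 ^ p) m
    rw [NPlus.mul_one] at h1
    exact dilogOp_commute h1 _ _
  rw [h, mul_prodRight (fun p => hc (p + 1)), mul_assoc, dilogOp_mul_self,
    ← mul_prodRight (x := dilogOp k ω L m (2 * (2 * c)))
      (u := fun p => centralOp k ω L m c (p + 1)),
    prodRight_succ']
  · congr 1
    rw [centralOp, pow_zero, pow_zero, NPlus.mul_one]
    congr 1
    ring
  · intro p
    rw [← dilogOp_mul_self, mul_assoc, hc, ← mul_assoc, hc, mul_assoc]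

theorem rayOp_eq_one {K : ℕ} (hK : VanishesFrom k L K) (n m : NPlus b) (c : ℚ) (p : ℕ)
    (hp : K ≤ p) : rayOp k ω L n m c p = 1 := by
  refine dilogOp_eq_one hK ?_ c
  rw [NPlus.deg_addMul]
  have h1 := NPlus.deg_pos n
  have h2 := NPlus.deg_pos m
  have h3 : (K : ℤ) ≤ p := by exact_mod_cast hp
  nlinarith

theorem centralOp_eq_one {K : ℕ} (hK : VanishesFrom k L K) (m : NPlus b) (c : ℚ) (p : ℕ)
    (hp : K ≤ p) : centralOp k ω L m c p = 1 := by
  refine dilogOp_eq_one hK ?_ _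
  rw [NPlus.deg_mul, PNat.pow_coe]
  have h2 := NPlus.deg_pos m
  have h3 : (K : ℤ) ≤ ((2 ^ p : ℕ) : ℤ) := by
    exact_mod_cast hp.trans Nat.lt_two_pow_self.le
  change (K : ℤ) ≤ ((2 ^ p : ℕ) : ℤ) * _
  nlinarith

/-- The factorization of `[n']^{2c} [n]^{2c}` in `G_L`. By two pentagon-type relations
`[n']^{2c} [n]^{2c} = [n]^{2c} [n + m]^c [m]^{2c} ([n']^c [n + m]^c) [m]^{2c} [n']^c` with
`m = n + n'`, and the product in the middle is an instance of the claim for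
`(n + m, n', c / 2)`, where the degree of the first vector is larger. -/
theorem dilogOp_factorization {K₀ : ℕ} (hK₀ : VanishesFrom k L K₀) (hpos : 0 < K₀) (d : ℕ) :
    ∀ (n n' : NPlus b) (c : ℚ), c ≠ 0 → ω.form (n' : N) (n : N) = c⁻¹ →
      (K₀ : ℤ) ≤ NPlus.deg n + d → ∀ K, K₀ ≤ K →
      dilogOp k ω L n' (2 * c) * dilogOp k ω L n (2 * c) =
        prodRight (rayOp k ω L n (n + n') (2 * c)) K * prodRight (centralOp k ω L (n + n') c) K *
          prodLeft (rayOp k ω L n' (n + n') (2 * c)) K := by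
  induction d with
  | zero =>
    intro n n' c _ _ hd K hK
    -- All factors are trivial except `[n']^{2c}`, the one with `p = 0` on the second ray.
    have hn : (K₀ : ℤ) ≤ NPlus.deg n := by simpa using hd
    have h' := NPlus.deg_pos n'
    have h1 : ∀ p, 0 ≤ p → rayOp k ω L n (n + n') (2 * c) p = 1 := fun p _ => by
      refine dilogOp_eq_one hK₀ ?_ _
      rw [NPlus.deg_addMul, NPlus.deg_add]
      nlinarith [(Nat.cast_nonneg p : (0 : ℤ) ≤ p)]
    have h2 : ∀ p, 0 ≤ p → centralOp k ω L (n + n') c p = 1 := fun p _ => by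
      refine dilogOp_eq_one hK₀ ?_ _
      rw [NPlus.deg_mul, NPlus.deg_add]
      have : (1 : ℤ) ≤ ((2 ^ p : ℕ+) : ℕ) := by exact_mod_cast one_le (a := (2 ^ p : ℕ+))
      nlinarith
    have h3 : ∀ p, 1 ≤ p → rayOp k ω L n' (n + n') (2 * c) p = 1 := fun p hp => by
      refine dilogOp_eq_one hK₀ ?_ _
      rw [NPlus.deg_addMul, NPlus.deg_add]
      have : (1 : ℤ) ≤ p := by exact_mod_cast hp
      nlinarith
    rw [prodRight_eq_of_le h1 (Nat.zero_le K), prodRight_eq_of_le h2 (Nat.zero_le K),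
      prodLeft_eq_of_le h3 (show 1 ≤ K by omega), dilogOp_eq_one hK₀ hn]
    simp [prodRight_zero, prodLeft_succ, prodLeft_zero, rayOp_zero]
  | succ d ih =>
    intro n n' c hc h hd K hK
    set m := n + n' with hm
    have hmn : ω.form (m : N) (n : N) = c⁻¹ := by
      rw [hm, AddMemClass.coe_add, map_add, LinearMap.add_apply, SkewForm.form_self, zero_add, h]
    have hnm : ω.form (n' : N) (m : N) = c⁻¹ := by
      rw [hm, AddMemClass.coe_add, map_add, SkewForm.form_self, add_zero, h]
    have hnm2 : ω.form (n' : N) ((n + m : NPlus b) : N) = (c / 2)⁻¹ := by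
      rw [AddMemClass.coe_add, map_add, h, hnm]
      field_simp
      norm_num
    have hdeg : (K₀ : ℤ) ≤ NPlus.deg (n + m) + d := by
      rw [NPlus.deg_add]
      have := NPlus.deg_pos m
      push_cast at hd
      omega
    have h1 := ih (n + m) n' (c / 2) (by positivity) hnm2 hdeg K hK
    have hm2 : n + m + n' = NPlus.mul 2 m := by
      refine Subtype.ext ?_
      change (n : N) + ((n : N) + (n' : N)) + (n' : N) = 2 • ((n : N) + (n' : N))
      rw [two_nsmul]
      abel
    have hR : rayOp k ω L (n + m) (n + m + n') c = fun p => rayOp k ω L n m c (2 * p + 1) := by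
      funext p
      simp only [rayOp]
      congr 1
      rw [hm2]
      refine Subtype.ext ?_
      change ((n : N) + (m : N)) + p • 2 • (m : N) = (n : N) + (2 * p + 1) • (m : N)
      rw [smul_smul, add_assoc, mul_comm p 2, succ_nsmul']
    have hL : rayOp k ω L n' (n + m + n') c = fun p => rayOp k ω L n' m c (2 * p) := by
      funext p
      simp only [rayOp]
      congr 1
      rw [hm2]
      refine Subtype.ext ?_
      change (n' : N) + p • 2 • (m : N) = (n' : N) + (2 * p) • (m : N)
      rw [smul_smul, mul_comm p 2]
    rw [mul_div_cancel₀ c (two_ne_zero' ℚ), hR, hL] at h1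
    have hfirst : dilogOp k ω L (n + m) c = rayOp k ω L n m c 1 := by
      simp only [rayOp, NPlus.addMul_succ, NPlus.addMul_zero, add_comm n m]
    calc dilogOp k ω L n' (2 * c) * dilogOp k ω L n (2 * c)
        = dilogOp k ω L n' c * (dilogOp k ω L n' c * dilogOp k ω L n (2 * c)) := by
          rw [← mul_assoc, dilogOp_mul_self]
      _ = dilogOp k ω L n' c * (dilogOp k ω L n (2 * c) * dilogOp k ω L (n + m) c *
            dilogOp k ω L m (2 * c) * dilogOp k ω L n' c) := by
          rw [dilogOp_mul_two_mul hc h]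
      _ = (dilogOp k ω L n' c * dilogOp k ω L n (2 * c)) * dilogOp k ω L (n + m) c *
            dilogOp k ω L m (2 * c) * dilogOp k ω L n' c := by
          simp only [mul_assoc]
      _ = dilogOp k ω L n (2 * c) * rayOp k ω L n m c 1 * dilogOp k ω L m (2 * c) *
            (dilogOp k ω L n' c * dilogOp k ω L (n + m) c) *
            dilogOp k ω L m (2 * c) * dilogOp k ω L n' c := by
          rw [dilogOp_mul_two_mul hc h, ← hm, hfirst]
          simp only [mul_assoc]
      _ = dilogOp k ω L n (2 * c) * rayOp k ω L n m c 1 *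
            (dilogOp k ω L m (2 * c) * prodRight (fun p => rayOp k ω L n m c (2 * p + 1)) K) *
            prodRight (centralOp k ω L (n + m + n') (c / 2)) K *
            (prodLeft (fun p => rayOp k ω L n' m c (2 * p)) K * dilogOp k ω L m (2 * c)) *
            dilogOp k ω L n' c := by
          rw [h1]
          simp only [mul_assoc]
      _ = (dilogOp k ω L n (2 * c) * rayOp k ω L n m c 1 *
            prodRight (fun p => rayOp k ω L n m c (2 * p + 1) *
              rayOp k ω L n m (2 * c) (2 * p + 2) * rayOp k ω L n m c (2 * p + 3)) K) *
            (dilogOp k ω L m (2 * c) * prodRight (centralOp k ω L (n + m + n') (c / 2)) K *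
              dilogOp k ω L m (2 * c)) *
            (prodLeft (fun p => rayOp k ω L n' m c (2 * p + 2) *
              rayOp k ω L n' m (2 * c) (2 * p + 1) * rayOp k ω L n' m c (2 * p)) K *
              dilogOp k ω L n' c) := by
          rw [dilogOp_mul_prodRight hc hmn, prodLeft_mul_dilogOp hc hnm]
          simp only [mul_assoc]
      _ = prodRight (rayOp k ω L n m (2 * c)) K * prodRight (centralOp k ω L m c) K *
            prodLeft (rayOp k ω L n' m (2 * c)) K := by
          rw [mul_prodRight_eq_prodRight, mul_centralOp_mul hm2, prodLeft_mul_eq_prodLeft,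
            rayOp_eq_one hK₀ n m c (2 * K + 1) (by omega),
            rayOp_eq_one hK₀ n' m c (2 * K) (by omega), mul_one, one_mul,
            prodRight_eq_of_le (fun p hp => rayOp_eq_one hK₀ n m (2 * c) p (hK.trans hp))
              (show K ≤ 2 * K + 1 by omega),
            prodRight_eq_of_le (fun p hp => centralOp_eq_one hK₀ m c p (hK.trans hp))
              (Nat.le_succ K),
            prodLeft_eq_of_le (fun p hp => rayOp_eq_one hK₀ n' m (2 * c) p (hK.trans hp))
              (show K ≤ 2 * K by omega)]

end FiniteFactorization

/-! ### Infinite products in the structure group -/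

section InfiniteProducts

open StructureGroup Filter

variable {N : Type*} [AddCommGroup N] {b : Module.Basis (Fin 2) ℤ N}
  {k : Type*} [Field k] [CharZero k] {ω : SkewForm N}

namespace StructureGroup

/-- The action of `G` on `FunMod k L`. -/
noncomputable def rep (L : CofiniteIdeal b) (g : StructureGroup k b ω) :
    Module.End k (FunMod k L) := StructureGroupMod.rep (proj L g)

theorem proj_eq_iff {L : CofiniteIdeal b} {g h : StructureGroup k b ω} :
    proj L g = proj L h ↔ rep L g = rep L h := StructureGroupMod.rep_injective.eq_iff.symm

theorem rep_mul (L : CofiniteIdeal b) (g h : StructureGroup k b ω) :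
    rep L (g * h) = rep L g * rep L h := StructureGroupMod.rep_mul _ _

theorem rep_list_prod (L : CofiniteIdeal b) (a : ℕ → StructureGroup k b ω) (l : List ℕ) :
    rep L (l.map a).prod = (l.map fun p => rep L (a p)).prod := by
  induction l with
  | nil => exact StructureGroupMod.rep_one
  | cons p l ih =>
    rw [List.map_cons, List.prod_cons, rep_mul, ih, List.map_cons, List.prod_cons]

theorem rep_dilog_pow (L : CofiniteIdeal b) (n : NPlus b) (c : ℚ) :
    rep L (dilog k ω n ^ c) = dilogOp k ω L n c := rfl

/-- A sequence in `G` whose images in every `G_L` are eventually constant converges. -/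
theorem exists_limit (P : ℕ → StructureGroup k b ω)
    (hP : ∀ L : CofiniteIdeal b, ∃ K, ∀ m, K ≤ m → rep L (P m) = rep L (P K)) :
    ∃ g : StructureGroup k b ω, ∀ L : CofiniteIdeal b, ∀ᶠ m in atTop, proj L (P m) = proj L g := by
  choose K hK using hP
  refine ⟨⟨fun L => proj L (P (K L)), fun L L' h => ?_⟩, fun L => ?_⟩
  · change StructureGroupMod.transition h (proj L (P (K L))) = proj L' (P (K L'))
    rw [← proj_eq_iff.2 (hK L _ (le_max_left (K L) (K L'))),
      ← proj_eq_iff.2 (hK L' _ (le_max_right (K L) (K L')))]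
    exact (P _).2 L L' h
  · filter_upwards [eventually_ge_atTop (K L)] with m hm
    exact proj_eq_iff.2 (hK L m hm)

theorem exists_isProdRight {a : ℕ → StructureGroup k b ω}
    (ha : ∀ L : CofiniteIdeal b, ∃ K, ∀ p, K ≤ p → rep L (a p) = 1) :
    ∃ g, IsProdRight a g :=
  exists_limit _ fun L => by
    obtain ⟨K, hK⟩ := ha L
    refine ⟨K, fun m hm => ?_⟩
    rw [rep_list_prod, rep_list_prod]
    exact prodRight_eq_of_le hK hm

theorem exists_isProdLeft {a : ℕ → StructureGroup k b ω}
    (ha : ∀ L : CofiniteIdeal b, ∃ K, ∀ p, K ≤ p → rep L (a p) = 1) :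
    ∃ g, IsProdLeft a g :=
  exists_limit _ fun L => by
    obtain ⟨K, hK⟩ := ha L
    refine ⟨K, fun m hm => ?_⟩
    rw [rep_list_prod, rep_list_prod]
    exact prodLeft_eq_of_le hK hm

theorem IsProdRight.isProd {a : ℕ → StructureGroup k b ω} {g : StructureGroup k b ω}
    (h : IsProdRight a g) (ha : ∀ L : CofiniteIdeal b, ∃ K, ∀ p, K ≤ p → rep L (a p) = 1)
    (hc : ∀ (L : CofiniteIdeal b) (p q : ℕ), Commute (rep L (a p)) (rep L (a q))) :
    IsProd a g := by
  intro L
  obtain ⟨K, hK⟩ := ha L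
  obtain ⟨m, hm, hKm⟩ := ((h L).and (eventually_ge_atTop K)).exists
  refine ⟨Finset.range K, fun l hl hF => ?_⟩
  rw [← hm, proj_eq_iff, rep_list_prod, rep_list_prod]
  rw [prod_map_eq_prodRight hK (hc L) hl fun p hp => hF p (Finset.mem_range.2 hp)]
  exact (prodRight_eq_of_le hK hKm).symm

end StructureGroup

end InfiniteProducts

theorem theorem3p1 {k : Type*} [Field k] [CharZero k] {N : Type*} [AddCommGroup N]
    (b : Module.Basis (Fin 2) ℤ N) (ω : SkewForm N) (n n' : NPlus b) (c : ℚ) (hc : c ≠ 0)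
    (h : ω.form (n' : N) (n : N) = c⁻¹) :
    ∃ A B C : StructureGroup k b ω,
      StructureGroup.IsProdRight
        (fun p => dilog k ω (NPlus.addMul n p (n + n')) ^ (2 * c)) A ∧
      StructureGroup.IsProd
        (fun p => dilog k ω (NPlus.mul (2 ^ p) (n + n')) ^ (4 * c / 2 ^ p)) B ∧
      StructureGroup.IsProdLeft
        (fun p => dilog k ω (NPlus.addMul n' p (n + n')) ^ (2 * c)) C ∧
      dilog k ω n' ^ (2 * c) * dilog k ω n ^ (2 * c) = A * B * C := by
  have hray : ∀ (n m : NPlus b) (L : CofiniteIdeal b), ∃ K, ∀ p, K ≤ p →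
      StructureGroup.rep L (dilog k ω (NPlus.addMul n p m) ^ (2 * c)) = 1 := fun n m L => by
    obtain ⟨K, hK⟩ := exists_vanishesFrom k L
    exact ⟨K, rayOp_eq_one hK n m (2 * c)⟩
  have hcentral : ∀ L : CofiniteIdeal b, ∃ K, ∀ p, K ≤ p →
      StructureGroup.rep L
        (dilog k ω (NPlus.mul (2 ^ p) (n + n')) ^ (4 * c / 2 ^ p)) = 1 := fun L => by
    obtain ⟨K, hK⟩ := exists_vanishesFrom k L
    exact ⟨K, centralOp_eq_one hK (n + n') c⟩
  -- The middle product is first taken in the order of the indices; its factors commute.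
  obtain ⟨A, hA⟩ := StructureGroup.exists_isProdRight (hray n (n + n'))
  obtain ⟨B, hB⟩ := StructureGroup.exists_isProdRight hcentral
  obtain ⟨C, hC⟩ := StructureGroup.exists_isProdLeft (hray n' (n + n'))
  refine ⟨A, B, C, hA, hB.isProd hcentral fun L => centralOp_commute (n + n') c, hC, ?_⟩
  refine Subtype.ext (funext fun L => ?_)
  change StructureGroup.proj L _ = StructureGroup.proj L _
  rw [StructureGroup.proj_eq_iff]
  obtain ⟨K₀, hK₀⟩ := exists_vanishesFrom k L
  obtain ⟨K, hKA, hKB, hKC, hK⟩ := ((hA L).and ((hB L).and ((hC L).and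
    (Filter.eventually_ge_atTop (K₀ + 1))))).exists
  simp only [StructureGroup.rep_mul]
  rw [← StructureGroup.proj_eq_iff.1 hKA, ← StructureGroup.proj_eq_iff.1 hKB,
    ← StructureGroup.proj_eq_iff.1 hKC]
  simp only [StructureGroup.rep_list_prod, StructureGroup.rep_dilog_pow]
  have hn := NPlus.deg_pos n
  exact dilogOp_factorization (hK₀.mono (Nat.le_succ K₀)) (Nat.succ_pos K₀) (K₀ + 1) n n' c hc h
    (by push_cast; omega) K hK
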